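/- Let $W\subset\mathbb R$ be open, let $\omega:W\to\mathbb R$ be real analytic, and let $F,G:\mathbb R\times W\times\mathbb R\to\mathbb R$, $(\alpha,A,t)\mapsto F(\alpha,A,t),G(\alpha,A,t)$, be real analytic and $2\pi$-periodic in $\alpha$ and in $t$. For a real parameter $\varepsilon$ consider $$\dot\alpha=\omega(A)+\varepsilon F(\alpha,A,t),\qquad \dot A=\varepsilon G(\alpha,A,t). \tag{1}$$ Let $A_0\in W$ be such that $\omega(A_0)=p/q$, with $p\in\mathbb Z\setminus\{0\}$ and $q\ge1$ relatively prime integers, and $\omega'(A_0)\neq0$. Put $T=2\pi q$, $\alpha_0(t)=\omega(A_0)t$, and write $\langle f\rangle=\frac1T\int_0^Tf(t)\,dt$ for the mean of a $T$-periodic function and $\mathcal I f$ for the $T$-periodic primitive of zero mean of $f-\langle f\rangle$. For $t_0\in\mathbb R$ define $T$-periodic functions $\beta^{(k)},B^{(k)}$, $k\ge1$, recursively by $$\beta^{(k)}=\mathcal I\Phi^{(k)}+\omega'(A_0)\,\mathcal I^2\Gamma^{(k)},\qquad B^{(k)}=\mathcal I\Gamma^{(k)}-\frac{\langle\Phi^{(k)}\rangle}{\omega'(A_0)},$$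 where $\Gamma^{(k)}(t)$ and $\Phi^{(k)}(t)$ are the coefficients of $\varepsilon^k$ in the formal expansions of $$\varepsilon G(\alpha(t),A(t),t+t_0)\quad\text{and}\quad \varepsilon F(\alpha(t),A(t),t+t_0)+\omega(A(t))-\omega(A_0)-\omega'(A_0)(A(t)-A_0)$$ along $\alpha(t)=\alpha_0(t)+\sum_{j\ge1}\varepsilon^j\beta^{(j)}(t)$, $A(t)=A_0+\sum_{j\ge1}\varepsilon^jB^{(j)}(t)$ (they involve only $\beta^{(j)},B^{(j)}$ with $j<k$). The subharmonic Melnikov functions are $M_k(t_0)=\langle\Gamma^{(k+1)}\rangle$, $k\ge0$; in particular $M_0(t_0)=\frac1T\int_0^TG(\alpha_0(t),A_0,t+t_0)\,dt$. Theorem. Suppose that for some $\kappa\ge0$ the functions $M_0,\dots,M_{\kappa-1}$ vanish identically and that $M_\kappa$ has a zero $t_0\in[0,2\pi)$ of finite odd order $n$, that is, $M_\kappa^{(j)}(t_0)=0$ for $0\le j\le n-1$ and $M_\kappa^{(n)}(t_0)\ne0$. Then there are $\varepsilon_0>0$ and functions $\alpha(t;\varepsilon),A(t;\varepsilon)$,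 defined for $|\varepsilon|<\varepsilon_0$ and $t\in\mathbb R$, such that for every such $\varepsilon$ one has $A(t;\varepsilon)\in W$, $$\dot\alpha=\omega(A)+\varepsilon F(\alpha,A,t+t_0),\qquad\dot A=\varepsilon G(\alpha,A,t+t_0),$$ $$\alpha(t+T;\varepsilon)=\alpha(t;\varepsilon)+2\pi p,\qquad A(t+T;\varepsilon)=A(t;\varepsilon),$$ so that $t\mapsto(\alpha(t-t_0;\varepsilon),A(t-t_0;\varepsilon))$ is a subharmonic solution of order $q/p$ of (1), and this solution is a convergent power series in $|\varepsilon|^{1/n!}$: for each sign $\sigma=\pm1$ there are continuous $T$-periodic functions $a_h,b_h$, $h\ge1$, such that for all $|\varepsilon|<\varepsilon_0$ with $\sigma\varepsilon\ge0$ $$\alpha(t;\varepsilon)=\alpha_0(t)+\sum_{h\ge1}a_h(t)\,|\varepsilon|^{h/n!},\qquad A(t;\varepsilon)=A_0+\sum_{h\ge1}b_h(t)\,|\varepsilon|^{h/n!},$$ and these series converge absolutely and uniformly in $t$, with $\sum_{h\ge1}\bigl(\sup_t|a_h(t)|+\sup_t|b_h(t)|\bigr)\,\varepsilon_0^{h/n!}<\infty$.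 -/

import Mathlib

noncomputable section

namespace Subharmonic

/-- The average `⟨f⟩ = (1/T) ∫₀ᵀ f` of a `T`-periodic function. -/
def mean (T : ℝ) (f : ℝ → ℝ) : ℝ := (1 / T) * ∫ t in (0 : ℝ)..T, f t

/-- The zero-mean `T`-periodic primitive of `f - ⟨f⟩`. In Fourier space (with basic frequency
`ϖ = 2π/T`) it divides the `ν`-th coefficient by `iϖν` for `ν ≠ 0` and annihilates the
`0`-th one. -/
def primitive (T : ℝ) (f : ℝ → ℝ) (t : ℝ) : ℝ :=
  (∫ s in (0 : ℝ)..t, (f s - mean T f)) -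
    mean T (fun u => ∫ s in (0 : ℝ)..u, (f s - mean T f))

/-- The coefficient of `ε ^ k` in the Taylor expansion of `f` at `ε = 0`. -/
def taylorCoeff (k : ℕ) (f : ℝ → ℝ) : ℝ := iteratedDeriv k f 0 / (k.factorial : ℝ)

/-- For an `ε`-dependent curve `x ε t = (α, A)`, the `k`-th order in `ε` of
`Γ(t) = ε G(α(t), A(t), t + t₀)`. -/
def gammaCoeff (G : ℝ → ℝ → ℝ → ℝ) (t₀ : ℝ) (k : ℕ) (x : ℝ → ℝ → ℝ × ℝ) (t : ℝ) : ℝ :=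
  taylorCoeff k (fun ε => ε * G (x ε t).1 (x ε t).2 (t + t₀))

/-- For an `ε`-dependent curve `x ε t = (α, A)`, the `k`-th order in `ε` of
`Φ(t) = ε F(α(t), A(t), t + t₀) + ω(A(t)) - ω(A₀) - ω'(A₀) (A(t) - A₀)`. -/
def phiCoeff (ω : ℝ → ℝ) (F : ℝ → ℝ → ℝ → ℝ) (A₀ t₀ : ℝ) (k : ℕ) (x : ℝ → ℝ → ℝ × ℝ)
    (t : ℝ) : ℝ :=
  taylorCoeff k (fun ε => ε * F (x ε t).1 (x ε t).2 (t + t₀) +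
    ω (x ε t).2 - ω A₀ - deriv ω A₀ * ((x ε t).2 - A₀))

/-- The truncation at order `k` in `ε` of the formal `T`-periodic perturbation
`(α₀(t) + ∑ εʲ βʲ(t), A₀ + ∑ εʲ Bʲ(t))` of the unperturbed motion `(ω(A₀) t, A₀)`, with the
average of every `βʲ` put equal to zero. The recursion is, in Fourier space,
`βʲ_ν = Φʲ_ν / (iϖν) + ω'(A₀) Γʲ_ν / (iϖν)²` and `Bʲ_ν = Γʲ_ν / (iϖν)` for `ν ≠ 0`, and
`Bʲ_0 = - Φʲ_0 / ω'(A₀)`. The orders `k + 1` of `Φ` and `Γ` depend only on the terms of order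
at most `k` of the curve, so they can be read off the truncation at order `k`. -/
def approx (ω : ℝ → ℝ) (F G : ℝ → ℝ → ℝ → ℝ) (A₀ T t₀ : ℝ) : ℕ → ℝ → ℝ → ℝ × ℝ
  | 0 => fun _ t => (ω A₀ * t, A₀)
  | k + 1 => fun ε t =>
      let x := approx ω F G A₀ T t₀ k
      let Φ := phiCoeff ω F A₀ t₀ (k + 1) x
      let Γ := gammaCoeff G t₀ (k + 1) x
      ((x ε t).1 + ε ^ (k + 1) *
          (primitive T Φ t + deriv ω A₀ * primitive T (primitive T Γ) t),
        (x ε t).2 + ε ^ (k + 1) * (primitive T Γ t - mean T Φ / deriv ω A₀))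

/-- The subharmonic Melnikov functions `M_k`, `k = 0, 1, 2, …`, of the resonant torus `A = A₀`
with `ω(A₀) = p / q`: `M_k(t₀)` is the average over the period `T = 2πq` of the order `k + 1`
in `ε` of `ε G`, evaluated along the formal perturbed motion with initial phase `t₀`. -/
def melnikov (ω : ℝ → ℝ) (F G : ℝ → ℝ → ℝ → ℝ) (A₀ : ℝ) (q : ℕ) (k : ℕ) (t₀ : ℝ) : ℝ :=
  mean (2 * Real.pi * q)
    (gammaCoeff G t₀ (k + 1) (approx ω F G A₀ (2 * Real.pi * q) t₀ k))

/-- `t ↦ (α(t), A(t))`, with time origin shifted by the initial phase `t₀` (so that the motion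
in the extended phase space is `(α(t), A(t), t + t₀)`), is a solution of
`α' = ω(A) + ε F(α, A, t)`, `A' = ε G(α, A, t)` which lies in `𝕋 × W` and closes up, after
time `2πq`, with `α` having made `p` turns; here `α` is a lift of the angle to `ℝ`. -/
structure IsPeriodicSolution (W : Set ℝ) (ω : ℝ → ℝ) (F G : ℝ → ℝ → ℝ → ℝ) (p : ℤ) (q : ℕ)
    (t₀ ε : ℝ) (α A : ℝ → ℝ) : Prop where
  mem : ∀ t, A t ∈ W
  hasDerivAt_angle : ∀ t, HasDerivAt α (ω (A t) + ε * F (α t) (A t) (t + t₀)) t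
  hasDerivAt_action : ∀ t, HasDerivAt A (ε * G (α t) (A t) (t + t₀)) t
  angle_period : ∀ t, α (t + 2 * Real.pi * q) = α t + 2 * Real.pi * p
  action_period : ∀ t, A (t + 2 * Real.pi * q) = A t

/-- For `|ε| < ε₀`, and separately for `ε ≥ 0` (`σ = 1`) and `ε ≤ 0` (`σ = -1`), the function
`u ε t` is the sum of a power series `∑_{h ≥ 1} c_h(t) |ε|^{h/N}` without constant term, whose
coefficients are continuous `T`-periodic functions of `t`, and which converges absolutely and
uniformly in `t`. -/
def HasPuiseuxSeries (N : ℕ) (T ε₀ : ℝ) (u : ℝ → ℝ → ℝ) : Prop :=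
  ∀ σ : ℝ, σ = 1 ∨ σ = -1 → ∃ (c : ℕ → ℝ → ℝ) (b : ℕ → ℝ),
    (∀ t, c 0 t = 0) ∧ (∀ h, Continuous (c h)) ∧ (∀ h, Function.Periodic (c h) T) ∧
    (∀ h t, |c h t| ≤ b h) ∧ Summable (fun h => b h * ε₀ ^ ((h : ℝ) / (N : ℝ))) ∧
    ∀ ε : ℝ, |ε| < ε₀ → 0 ≤ σ * ε → ∀ t,
      HasSum (fun h => c h t * |ε| ^ ((h : ℝ) / (N : ℝ))) (u ε t)

end Subharmonic

end

/-! The proof is a Lyapunov–Schmidt reduction followed by a real Newton–Puiseux argument.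

Put `ν = ω(A₀)` and look for solutions `α = νt + b + β(t)`, `A = A₀ + B(t)`, where `b` is a constant
and `β`, `B` are continuous functions on the circle of length `T`. With `D` the function `G` along
the curve and `Γ = εD`, the recursion of the theorem becomes a fixed-point system, the range
equations: `β = 𝓘Φ + ω'(A₀)𝓘²Γ`, `B = 𝓘Γ - ⟨Φ⟩/ω'(A₀)`. Composition with an analytic function is an
analytic operator on continuous functions (`analyticAt_superpose`), and at `ε = 0` the right-hand
sides are of second order in `B`, so the implicit function theorem solves the system analytically in
`(b, ε)` (`exists_reduction`). The resulting curve is a true solution as soon as `H(b, ε) = ⟨D⟩`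
vanishes (`isPeriodicSolution_of_range_equations`).

Adding `b` to the angle amounts to translating time by `s = b/ν` and replacing the phase `t₀` by `t₀
- s`. Since the Taylor coefficients of the analytic solution obey the formal recursion, the
coefficients in `ε` of `H(b, ·)` are the numbers `M_k(t₀ - b/ν)` (`melnikov_eq_taylorCoeff`). Hence
`H = ε^κ g(ε, b)` with `g(0, b) = M_κ(t₀ - b/ν)` of odd order `n` at `b = 0`
(`exists_bifurcation_function`).

It remains to find a real branch of `g = 0` over each half-line in `ε` (`exists_puiseux_root`). A
shift of `b` removes the subleading coefficient. An edge of the Newton polygon then gives a real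
polynomial of odd degree `n`, which has a real root of odd multiplicity, and this multiplicity is
less than `n` because of the shift. Blowing up at that root lowers the order, and induction ends at
a convergent branch. A step with denominator `m` and multiplicity `a` satisfies `m · a! ∣ n!`, which
accounts for the exponent `1/n!`. -/

noncomputable section

namespace Subharmonic

open Filter Topology

/-! ### Analyticity of superposition operators on `C(K, E)` -/

section Superposition

variable {K E G : Type*} [TopologicalSpace K] [NormedAddCommGroup E] [NormedAddCommGroup G]

/-- The superposition operator `u ↦ f ∘ u` on continuous functions, with value `0` where `f ∘ u`
is not continuous. -/
def superpose (f : E → G) (u : C(K, E)) : C(K, G) :=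
  open Classical in if h : Continuous (fun k => f (u k)) then ⟨_, h⟩ else 0

theorem superpose_apply {f : E → G} {u : C(K, E)} (h : ∀ k, ContinuousAt f (u k)) (k : K) :
    superpose f u k = f (u k) := by
  have : Continuous (fun k => f (u k)) :=
    continuous_iff_continuousAt.2 fun k => (h k).comp u.continuous.continuousAt
  simp [superpose, this]

variable [CompactSpace K]

theorem isOpen_setOf_forall_mem {U : Set E} (hU : IsOpen U) :
    IsOpen {u : C(K, E) | ∀ k, u k ∈ U} := by
  simpa [Set.MapsTo] using ContinuousMap.isOpen_setOfPred_mapsTo (isCompact_univ (X := K)) hU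

variable [NormedSpace ℝ E] [NormedSpace ℝ G]

/-- A multilinear map acting pointwise on continuous functions. -/
def pointwiseMultilinear {n : ℕ} (m : E [×n]→L[ℝ] G) : C(K, E) [×n]→L[ℝ] C(K, G) :=
  MultilinearMap.mkContinuous
    { toFun := fun u => ⟨fun k => m fun i => u i k, by fun_prop⟩
      map_update_add' := by
        intro _ u i x y
        ext k
        have h (z : C(K, E)) : (fun j => Function.update u i z j k) =
            Function.update (fun j => u j k) i (z k) := by
          ext j; by_cases hj : j = i
          · subst hj; simp
          · simp [hj]
        simp [h]
      map_update_smul' := by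
        intro _ u i c x
        ext k
        have h (z : C(K, E)) : (fun j => Function.update u i z j k) =
            Function.update (fun j => u j k) i (z k) := by
          ext j; by_cases hj : j = i
          · subst hj; simp
          · simp [hj]
        simp [h] } ‖m‖ fun u => by
      refine (ContinuousMap.norm_le _ (by positivity)).2 fun k => ?_
      refine (m.le_opNorm _).trans ?_
      gcongr with i
      exact (u i).norm_coe_le_norm k

theorem norm_pointwiseMultilinear_le {n : ℕ} (m : E [×n]→L[ℝ] G) :
    ‖(pointwiseMultilinear m : C(K, E) [×n]→L[ℝ] C(K, G))‖ ≤ ‖m‖ :=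
  MultilinearMap.mkContinuous_norm_le _ (norm_nonneg _) _

/-- At a constant function the power series of `f` can be applied pointwise: the pointwise
multilinear maps have no larger norms, so the radius is not lost, and evaluation at each point
identifies the sum. -/
theorem hasFPowerSeriesOnBall_superpose_const [CompleteSpace G] {f : E → G}
    {p : FormalMultilinearSeries ℝ E G} {z : E} {r : ENNReal} (h : HasFPowerSeriesOnBall f p z r) :
    HasFPowerSeriesOnBall (superpose f : C(K, E) → C(K, G)) (fun n => pointwiseMultilinear (p n))
      (ContinuousMap.const K z) r where
  r_le := h.r_le.trans <| by
    refine FormalMultilinearSeries.radius_le_of_le fun n => ?_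
    exact norm_pointwiseMultilinear_le (p n)
  r_pos := h.r_pos
  hasSum := by
    intro y hy
    have hy' : ∀ k, y k ∈ Metric.eball (0 : E) r := by
      intro k
      simp only [Metric.mem_eball, edist_zero_right] at hy ⊢
      refine lt_of_le_of_lt ?_ hy
      rw [enorm_le_iff_norm_le]
      exact y.norm_coe_le_norm k
    have hc : ∀ k, ContinuousAt f ((ContinuousMap.const K z + y) k) := fun k =>
      (h.analyticAt_of_mem (by simpa [edist_eq_enorm_sub] using hy' k)).continuousAt
    have hs : Summable fun n => (pointwiseMultilinear (p n) : C(K, E) [×n]→L[ℝ] C(K, G))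
        fun _ => y := by
      refine Summable.of_norm_bounded (p.summable_norm_mul_pow (r := ‖y‖₊) ?_) fun n => ?_
      · simp only [Metric.mem_eball, edist_zero_right] at hy
        exact lt_of_lt_of_le hy h.r_le
      · refine (ContinuousMultilinearMap.le_opNorm _ _).trans ?_
        simp only [Finset.prod_const, Finset.card_univ, Fintype.card_fin, coe_nnnorm]
        gcongr
        exact norm_pointwiseMultilinear_le (p n)
    suffices superpose f (ContinuousMap.const K z + y) = _ by rw [this]; exact hs.hasSum
    ext k
    rw [superpose_apply hc]
    have h1 := (ContinuousMap.evalCLM ℝ k).hasSum hs.hasSum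
    exact (h.hasSum (hy' k)).unique h1

/-- Multiplication of a continuous function by a continuous scalar. -/
def mulCLM (χ : C(K, ℝ)) : C(K, G) →L[ℝ] C(K, G) :=
  LinearMap.mkContinuous
    { toFun := fun u => χ • u
      map_add' := fun u v => smul_add _ _ _
      map_smul' := fun c u => by ext k; exact smul_comm _ _ _ } ‖χ‖ fun u => by
      refine (ContinuousMap.norm_le _ (by positivity)).2 fun k => ?_
      change ‖χ k • u k‖ ≤ _
      rw [norm_smul]
      gcongr
      · exact χ.norm_coe_le_norm k
      · exact u.norm_coe_le_norm k

@[simp]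
theorem mulCLM_apply (χ : C(K, ℝ)) (u : C(K, G)) (k : K) : mulCLM χ u k = χ k • u k := rfl

/-- Analyticity can be tested locally on `K`: finitely many of the sets `χ > 0` cover `K`, so `∑ χ
i` is positive, and `Ψ` is recovered from the `χ i • Ψ` by the bounded linear operator of division
by this sum. -/
theorem analyticAt_of_forall_exists_mulCLM {V : Type*} [NormedAddCommGroup V] [NormedSpace ℝ V]
    {Ψ : V → C(K, G)} {v : V}
    (h : ∀ k : K, ∃ χ : C(K, ℝ), (∀ k, 0 ≤ χ k) ∧ 0 < χ k ∧
      AnalyticAt ℝ (fun w => mulCLM χ (Ψ w)) v) :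
    AnalyticAt ℝ Ψ v := by
  choose χ h0 h1 h2 using h
  obtain ⟨s, hs⟩ := CompactSpace.elim_nhds_subcover (fun k => {k' | 0 < χ k k'})
    fun k => (isOpen_lt continuous_const (χ k).continuous).mem_nhds (h1 k)
  have hpos : ∀ k, 0 < ∑ i ∈ s, χ i k := by
    intro k
    have hk : k ∈ ⋃ i ∈ s, {k' | 0 < χ i k'} := by rw [hs]; trivial
    simp only [Set.mem_iUnion] at hk
    obtain ⟨i, hi, hik⟩ := hk
    exact Finset.sum_pos' (fun j _ => h0 j k) ⟨i, hi, hik⟩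
  let S : C(K, ℝ) := ⟨fun k => (∑ i ∈ s, χ i k)⁻¹,
    Continuous.inv₀ (by fun_prop) fun k => (hpos k).ne'⟩
  have : Ψ = fun w => mulCLM S (∑ i ∈ s, mulCLM (χ i) (Ψ w)) := by
    ext w k
    have : (∑ i ∈ s, mulCLM (χ i) (Ψ w)) k = (∑ i ∈ s, χ i k) • Ψ w k := by
      simp [Finset.sum_smul]
    rw [mulCLM_apply, this, smul_smul]
    simp [S, (hpos k).ne']
  rw [this]
  exact ((mulCLM S).analyticAt _).comp (Finset.analyticAt_fun_sum _ fun i _ => h2 i)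

theorem eventually_superpose_apply [CompleteSpace G] {f : E → G} {u : C(K, E)}
    (h : ∀ k, AnalyticAt ℝ f (u k)) :
    ∀ᶠ v in 𝓝 u, ∀ k, AnalyticAt ℝ f (v k) ∧ superpose f v k = f (v k) := by
  filter_upwards [(isOpen_setOf_forall_mem (K := K) (isOpen_analyticAt ℝ f)).mem_nhds h] with v hv k
  exact ⟨hv k, superpose_apply (fun k => (hv k).continuousAt) k⟩

/-- No single power series of `f` need cover the whole range of `u`. Near each point `k₀` the
function `v` is replaced by one that stays in a ball around `u k₀` and agrees with `v` where a
cutoff is nonzero; there the expansion at a constant function applies. -/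
theorem analyticAt_superpose [CompleteSpace G] {f : E → G} {u : C(K, E)}
    (h : ∀ k, AnalyticAt ℝ f (u k)) : AnalyticAt ℝ (superpose f : C(K, E) → C(K, G)) u := by
  refine analyticAt_of_forall_exists_mulCLM fun k₀ => ?_
  obtain ⟨p, r', hp'⟩ := h k₀
  obtain ⟨r, hr0, hr'⟩ := ENNReal.lt_iff_exists_nnreal_btwn.1 hp'.r_pos
  have hp := hp'.mono hr0 hr'.le
  replace hr0 : 0 < (r : ℝ) := by exact_mod_cast hr0
  set z := u k₀
  -- `χ` lives on `‖u - z‖ < r/4`; `η` is `1` there and `0` once `‖u - z‖ ≥ r/2`. Thus `Θ u` stays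
  -- within `r/2` of the constant `z`, while `Θ v = v` wherever `χ ≠ 0`.
  let χ : C(K, ℝ) := ⟨fun k => max 0 (r / 4 - ‖u k - z‖), by fun_prop⟩
  let η : C(K, ℝ) := ⟨fun k => max 0 (min 1 (2 - 4 / r * ‖u k - z‖)), by fun_prop⟩
  have hη : ∀ k, χ k ≠ 0 → η k = 1 := by
    intro k hk
    have h1 : ‖u k - z‖ < r / 4 := by
      by_contra! hc
      exact hk (max_eq_left (by linarith))
    have h2 : 4 / r * ‖u k - z‖ ≤ 1 := by
      rw [div_mul_eq_mul_div, div_le_one hr0]; linarith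
    change max 0 (min 1 (2 - 4 / r * ‖u k - z‖)) = 1
    rw [min_eq_left (by linarith), max_eq_right zero_le_one]
  let Θ : C(K, E) → C(K, E) := fun v => ContinuousMap.const K z + mulCLM η (v - ContinuousMap.const K z)
  have hΘ : AnalyticAt ℝ Θ u :=
    analyticAt_const.add <|
      ((mulCLM η).analyticAt _).fun_comp (f := fun v : C(K, E) => v - ContinuousMap.const K z)
        (analyticAt_id.fun_sub analyticAt_const)
  have hmem : Θ u ∈ Metric.eball (ContinuousMap.const K z) (r : ENNReal) := by
    rw [Metric.mem_eball, edist_nndist, ENNReal.coe_lt_coe, ← NNReal.coe_lt_coe, coe_nndist]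
    have : dist (Θ u) (ContinuousMap.const K z) ≤ r / 2 := by
      refine (ContinuousMap.dist_le (by positivity)).2 fun k => ?_
      have h1 : dist (Θ u k) (ContinuousMap.const K z k) = η k * ‖u k - z‖ := by
        have : 0 ≤ η k := le_max_left _ _
        rw [dist_eq_norm, show Θ u k - ContinuousMap.const K z k = η k • (u k - z) from
          add_sub_cancel_left _ _, norm_smul, Real.norm_of_nonneg this]
      rw [h1]
      rcases le_or_gt ‖u k - z‖ (r / 2) with h2 | h2
      · have h3 : η k ≤ 1 := max_le zero_le_one (min_le_left _ _)
        nlinarith [norm_nonneg (u k - z)]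
      · have h3 : η k = 0 := by
          refine max_eq_left ((min_le_right _ _).trans ?_)
          have : 2 ≤ 4 / r * ‖u k - z‖ := by
            rw [div_mul_eq_mul_div, le_div_iff₀ hr0]; linarith
          linarith
        rw [h3]; simp; positivity
    linarith
  have hser := hasFPowerSeriesOnBall_superpose_const (K := K) hp
  refine ⟨χ, fun k => le_max_left _ _, ?_, ?_⟩
  · change 0 < max 0 (r / 4 - ‖u k₀ - z‖)
    simp [z, hr0]
  · have h1 : AnalyticAt ℝ (fun w => mulCLM χ (superpose f (Θ w))) u :=
      ((mulCLM χ).analyticAt _).fun_comp (f := superpose f ∘ Θ)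
        ((hser.analyticAt_of_mem hmem).comp hΘ)
    refine h1.congr ?_
    have hin := hΘ.continuousAt.eventually (Metric.isOpen_eball.mem_nhds hmem)
    filter_upwards [hin, eventually_superpose_apply h] with w hw hw'
    ext k
    simp only [mulCLM_apply]
    by_cases hk : χ k = 0
    · simp [hk]
    · have hwk : ∀ k, ContinuousAt f (Θ w k) := by
        intro k
        refine (hp.analyticAt_of_mem ?_).continuousAt
        rw [Metric.mem_eball]
        refine lt_of_le_of_lt ?_ hw
        rw [edist_dist, edist_dist]
        exact ENNReal.ofReal_le_ofReal
          (ContinuousMap.dist_apply_le_dist (f := Θ w) (g := ContinuousMap.const K z) k)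
      rw [superpose_apply hwk, (hw' k).2]
      have : Θ w k = w k := by simp [Θ, hη k hk]
      rw [this]

end Superposition

end Subharmonic

end

noncomputable section

namespace Subharmonic

open Filter Topology

/-! ### Division by a variable and Taylor expansion with analytic parameters -/

section Hadamard

variable {E : Type*} [NormedAddCommGroup E] [NormedSpace ℝ E]

/-- Integration over the unit interval. -/
def unitIntegral : C(unitInterval, ℝ) →L[ℝ] ℝ :=
  LinearMap.mkContinuous
    { toFun := fun u => ∫ θ in (0 : ℝ)..1, u (Set.projIcc 0 1 zero_le_one θ)
      map_add' := fun u v => by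
        simp only [ContinuousMap.add_apply]
        exact intervalIntegral.integral_add
          (Continuous.intervalIntegrable (by fun_prop) _ _)
          (Continuous.intervalIntegrable (by fun_prop) _ _)
      map_smul' := fun c u => by simp } 1 fun u => by
      have := intervalIntegral.norm_integral_le_of_norm_le_const (a := 0) (b := 1) (C := ‖u‖)
        (f := fun θ => u (Set.projIcc 0 1 zero_le_one θ)) fun x _ => u.norm_coe_le_norm _
      simpa using this

/-- The segment from `(e, 0)` to `(e, x)`, as a function of `(e, x)`. -/
def fiberSegment : E × ℝ →L[ℝ] C(unitInterval, E × ℝ) :=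
  LinearMap.mkContinuous
    { toFun := fun v => ⟨fun θ => (v.1, (θ : ℝ) * v.2), by fun_prop⟩
      map_add' := fun u v => by ext θ <;> simp [mul_add]
      map_smul' := fun c v => by ext θ <;> simp [mul_left_comm] } 1 fun v => by
      refine (ContinuousMap.norm_le _ (by positivity)).2 fun θ => ?_
      simp only [one_mul]
      refine max_le (le_max_left _ _) ?_
      refine le_trans ?_ (le_max_right _ _)
      have h1 : |(θ : ℝ)| ≤ 1 := by rw [abs_of_nonneg θ.2.1]; exact θ.2.2
      change ‖(θ : ℝ) * v.2‖ ≤ _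
      rw [norm_mul, Real.norm_eq_abs]
      exact mul_le_of_le_one_left (norm_nonneg _) h1

@[simp]
theorem fiberSegment_apply (v : E × ℝ) (θ : unitInterval) :
    fiberSegment v θ = (v.1, (θ : ℝ) * v.2) := rfl

/-- `f(e, x) - f(e, 0) = x ∫₀¹ ∂₂f(e, θx) dθ`. The integral is analytic in `(e, x)`, being a linear
functional of a superposition along the segment. -/
theorem exists_hadamard [CompleteSpace E] {f : E × ℝ → ℝ} {e : E} (hf : AnalyticAt ℝ f (e, 0)) :
    ∃ g : E × ℝ → ℝ, AnalyticAt ℝ g (e, 0) ∧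
      ∀ᶠ v in 𝓝 (e, (0 : ℝ)), f v = f (v.1, 0) + v.2 * g v := by
  let d : E × ℝ → ℝ := fun w => fderiv ℝ f w (0, 1)
  have hd : AnalyticAt ℝ d (e, 0) := by
    have := hf.fderiv
    exact (ContinuousLinearMap.apply ℝ ℝ ((0 : E), (1 : ℝ))).analyticAt _ |>.fun_comp this
  have hbase : ∀ θ, fiberSegment (e, (0 : ℝ)) θ = (e, 0) := by intro θ; simp
  have hd' : ∀ θ, AnalyticAt ℝ d (fiberSegment (e, (0 : ℝ)) θ) := by
    intro θ; rw [hbase]; exact hd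
  have hf' : ∀ θ, AnalyticAt ℝ f (fiberSegment (e, (0 : ℝ)) θ) := by
    intro θ; rw [hbase]; exact hf
  refine ⟨fun v => unitIntegral (superpose d (fiberSegment v)), ?_, ?_⟩
  · exact (unitIntegral.analyticAt _).fun_comp
      ((analyticAt_superpose hd').fun_comp (f := fiberSegment) (fiberSegment.analyticAt (e, (0 : ℝ))))
  have hc : Tendsto (fiberSegment : E × ℝ → _) (𝓝 (e, 0)) (𝓝 (fiberSegment (e, (0 : ℝ)))) :=
    fiberSegment.continuous.tendsto _
  filter_upwards [hc.eventually (eventually_superpose_apply hd'),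
    hc.eventually (eventually_superpose_apply hf')] with v hv1 hv2
  have hint : ∫ θ in (0 : ℝ)..1, v.2 * superpose d (fiberSegment v)
      (Set.projIcc 0 1 zero_le_one θ) = f (v.1, 1 * v.2) - f (v.1, 0 * v.2) := by
    refine intervalIntegral.integral_eq_sub_of_hasDerivAt (f := fun θ : ℝ => f (v.1, θ * v.2)) ?_
      (Continuous.intervalIntegrable (by fun_prop) _ _)
    intro θ hθ
    rw [Set.uIcc_of_le zero_le_one] at hθ
    rw [(hv1 _).2, Set.projIcc_of_mem _ hθ]
    have h1 := (hv2 ⟨θ, hθ⟩).1.differentiableAt.hasFDerivAt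
    have h2 : HasDerivAt (fun θ : ℝ => (v.1, θ * v.2)) ((0 : E), v.2) θ :=
      (hasDerivAt_const θ v.1).prodMk (by simpa using (hasDerivAt_id θ).mul_const v.2)
    have h3 := h1.comp_hasDerivAt θ h2
    refine HasDerivAt.congr_deriv (f := f ∘ fun θ => (v.1, θ * v.2)) h3 ?_
    have : ((0 : E), v.2) = v.2 • ((0 : E), (1 : ℝ)) := by simp
    rw [this, map_smul]; rfl
  rw [intervalIntegral.integral_const_mul] at hint
  change f v = f (v.1, 0) + v.2 * ∫ θ in (0 : ℝ)..1, superpose d (fiberSegment v)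
      (Set.projIcc 0 1 zero_le_one θ)
  rw [hint]; simp

theorem exists_fiber_taylor [CompleteSpace E] {f : E × ℝ → ℝ} {e : E} (hf : AnalyticAt ℝ f (e, 0))
    (n : ℕ) : ∃ (a : ℕ → E → ℝ) (h : E × ℝ → ℝ), (∀ j, AnalyticAt ℝ (a j) e) ∧
      AnalyticAt ℝ h (e, 0) ∧ ∀ᶠ v in 𝓝 (e, (0 : ℝ)),
        f v = ∑ j ∈ Finset.range n, a j v.1 * v.2 ^ j + v.2 ^ n * h v := by
  induction n with
  | zero => exact ⟨fun _ _ => 0, f, fun _ => analyticAt_const, hf, by simp⟩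
  | succ n ih =>
    obtain ⟨a, h, ha, hh, hE⟩ := ih
    obtain ⟨g, hg, hE'⟩ := exists_hadamard hh
    refine ⟨Function.update a n fun x => h (x, 0), g, fun j => ?_, hg, ?_⟩
    · by_cases hj : j = n
      · subst hj
        rw [Function.update_self]
        exact hh.fun_comp (f := fun x => (x, (0 : ℝ))) (analyticAt_id.prod analyticAt_const)
      · rw [Function.update_of_ne hj]; exact ha j
    · filter_upwards [hE, hE'] with v h1 h2
      rw [h1, h2, Finset.sum_range_succ, Function.update_self]
      have : ∑ j ∈ Finset.range n, Function.update a n (fun x => h (x, 0)) j v.1 * v.2 ^ j =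
          ∑ j ∈ Finset.range n, a j v.1 * v.2 ^ j := by
        refine Finset.sum_congr rfl fun j hj => ?_
        rw [Function.update_of_ne (Finset.mem_range.1 hj).ne]
      rw [this]
      ring

end Hadamard

/-! ### Taylor coefficients and orders of vanishing -/

section TaylorCoeff

theorem taylorCoeff_congr {f g : ℝ → ℝ} (h : f =ᶠ[𝓝 0] g) (k : ℕ) :
    taylorCoeff k f = taylorCoeff k g := by
  rw [taylorCoeff, taylorCoeff, h.iteratedDeriv_eq]

theorem taylorCoeff_sub {f g : ℝ → ℝ} (hf : AnalyticAt ℝ f 0) (hg : AnalyticAt ℝ g 0) (k : ℕ) :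
    taylorCoeff k (fun x => f x - g x) = taylorCoeff k f - taylorCoeff k g := by
  rw [taylorCoeff, taylorCoeff, taylorCoeff, iteratedDeriv_fun_sub hf.contDiffAt hg.contDiffAt,
    sub_div]

/-- An order `m ≤ n` would give `f = x ^ m * g` with `g 0 ≠ 0`, whereas `f = o(x ^ n)` forces `g →
0` on the punctured neighbourhood. -/
theorem le_analyticOrderAt_of_isLittleO {f : ℝ → ℝ} (hf : AnalyticAt ℝ f 0) {n : ℕ}
    (h : f =o[𝓝 0] fun x => x ^ n) : ((n + 1 : ℕ) : ℕ∞) ≤ analyticOrderAt f 0 := by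
  by_contra! hlt
  obtain ⟨m, hm⟩ := ENat.ne_top_iff_exists.1 (ne_top_of_lt hlt)
  rw [← hm, Nat.cast_lt] at hlt
  obtain ⟨g, hg, hg0, hfg⟩ := (hf.analyticOrderAt_eq_natCast).1 hm.symm
  simp only [sub_zero, smul_eq_mul] at hfg
  have h1 : (fun x : ℝ => x ^ n) =O[𝓝 0] fun x => x ^ m := by
    rcases (Nat.lt_succ_iff.1 hlt).eq_or_lt with rfl | h1
    · exact Asymptotics.isBigO_refl _ _
    · exact (Asymptotics.isLittleO_pow_pow h1).isBigO
  have h2 : (fun x : ℝ => x ^ m * g x) =o[𝓝 0] fun x => x ^ m * 1 :=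
    ((h.trans_isBigO h1).congr' hfg (by simp))
  have h3 : (fun x : ℝ => x ^ m * g x) =o[𝓝[≠] 0] fun x => x ^ m * 1 :=
    h2.mono nhdsWithin_le_nhds
  have h4 : g =o[𝓝[≠] 0] fun _ => (1 : ℝ) := by
    rw [Asymptotics.isLittleO_iff] at h3 ⊢
    intro c hc
    filter_upwards [h3 hc, self_mem_nhdsWithin] with x hx hx0
    have : 0 < ‖x ^ m‖ := norm_pos_iff.2 (pow_ne_zero _ hx0)
    rw [norm_mul, norm_mul, mul_left_comm] at hx
    exact le_of_mul_le_mul_left hx this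
  rw [Asymptotics.isLittleO_one_iff] at h4
  exact hg0 (tendsto_nhds_unique (hg.continuousAt.tendsto.mono_left nhdsWithin_le_nhds) h4)

theorem taylorCoeff_eq_zero_of_isLittleO {f : ℝ → ℝ} (hf : AnalyticAt ℝ f 0) {n : ℕ}
    (h : f =o[𝓝 0] fun x => x ^ n) {k : ℕ} (hk : k ≤ n) : taylorCoeff k f = 0 := by
  have := (natCast_le_analyticOrderAt_iff_iteratedDeriv_eq_zero hf).1
    (le_analyticOrderAt_of_isLittleO hf h) k (by omega)
  rw [taylorCoeff, this, zero_div]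

theorem taylorCoeff_eq_of_isLittleO {f g : ℝ → ℝ} (hf : AnalyticAt ℝ f 0) (hg : AnalyticAt ℝ g 0)
    {n : ℕ} (h : (fun x => f x - g x) =o[𝓝 0] fun x => x ^ n) {k : ℕ} (hk : k ≤ n) :
    taylorCoeff k f = taylorCoeff k g := by
  have := taylorCoeff_eq_zero_of_isLittleO (hf.fun_sub hg) h hk
  rwa [taylorCoeff_sub hf hg, sub_eq_zero] at this

theorem taylorCoeff_sum_pow (c : ℕ → ℝ) (n : ℕ) {k : ℕ} (hk : k < n) :
    taylorCoeff k (fun x => ∑ j ∈ Finset.range n, c j * x ^ j) = c k := by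
  have hkf : (k.factorial : ℝ) ≠ 0 := by positivity
  rw [taylorCoeff, div_eq_iff hkf]
  rw [iteratedDeriv_fun_sum (fun i _ => by fun_prop)]
  simp (disch := fun_prop) only [iteratedDeriv_const_mul_field, iteratedDeriv_fun_pow_zero]
  simp [Finset.sum_ite_eq_of_mem _ _ _ (Finset.mem_range.mpr hk)]

theorem taylorCoeff_of_eventuallyEq {f h : ℝ → ℝ} {c : ℕ → ℝ} {n : ℕ} (hh : AnalyticAt ℝ h 0)
    (hf : ∀ᶠ x in 𝓝 0, f x = ∑ j ∈ Finset.range n, c j * x ^ j + x ^ n * h x) {k : ℕ} (hk : k < n) :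
    taylorCoeff k f = c k := by
  rw [taylorCoeff_congr hf, ← taylorCoeff_sum_pow c n hk]
  have h1 : AnalyticAt ℝ (fun x : ℝ => ∑ j ∈ Finset.range n, c j * x ^ j) 0 := by fun_prop
  refine taylorCoeff_eq_of_isLittleO (h1.fun_add (by fun_prop)) h1 (n := k) ?_ le_rfl
  simp only [add_sub_cancel_left]
  have h2 : (fun x : ℝ => x ^ n) =o[𝓝 0] fun x => x ^ k := Asymptotics.isLittleO_pow_pow hk
  have h3 : h =O[𝓝 0] fun _ => (1 : ℝ) := hh.continuousAt.isBigO_one ℝ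
  simpa using h2.mul_isBigO h3

end TaylorCoeff

end Subharmonic

end

noncomputable section

namespace Subharmonic

open Filter Topology

/-! ### Real roots of odd multiplicity and the factorial bound on denominators -/

section RealPolynomial

open Polynomial

/-- `P(-x) P(x)` has negative leading coefficient, so for some `x` the values at `±x` have opposite
signs. -/
theorem exists_isRoot_of_odd_natDegree {P : ℝ[X]} (h : Odd P.natDegree) : ∃ x, P.IsRoot x := by
  have hP : P ≠ 0 := by rintro rfl; simp at h
  have hdeg : (P.comp (-X)).natDegree = P.natDegree := by simp [natDegree_comp]
  have hlc : (P.comp (-X)).leadingCoeff = -P.leadingCoeff := by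
    simp [comp_neg_X_leadingCoeff_eq, h.neg_one_pow]
  have hQ : P.comp (-X) ≠ 0 := by
    rw [← leadingCoeff_ne_zero, hlc]; simpa using hP
  have ht := (P.comp (-X) * P).tendsto_atBot_of_leadingCoeff_nonpos
    (by rw [← natDegree_pos_iff_degree_pos, natDegree_mul hQ hP]; have := h.pos; omega)
    (by rw [leadingCoeff_mul, hlc]; nlinarith [mul_self_nonneg P.leadingCoeff])
  obtain ⟨x, hx, -⟩ := ((ht.eventually_lt_atBot 0).and (eventually_ge_atTop 0)).exists
  simp only [eval_mul, eval_comp, eval_neg, eval_X] at hx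
  rcases mul_neg_iff.1 hx with ⟨h1, h2⟩ | ⟨h1, h2⟩
  · have := intermediate_value_uIcc (a := -x) (b := x) (f := fun y => P.eval y)
      P.continuous.continuousOn
    obtain ⟨y, -, hy⟩ := this (Set.mem_uIcc.2 (Or.inr ⟨h2.le, h1.le⟩))
    exact ⟨y, hy⟩
  · have := intermediate_value_uIcc (a := -x) (b := x) (f := fun y => P.eval y)
      P.continuous.continuousOn
    obtain ⟨y, -, hy⟩ := this (Set.mem_uIcc.2 (Or.inl ⟨h1.le, h2.le⟩))
    exact ⟨y, hy⟩

/-- Dividing out all real roots leaves a factor without real roots, hence of even degree; the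
multiplicities therefore have odd sum. -/
theorem exists_odd_rootMultiplicity {P : ℝ[X]} (h : Odd P.natDegree) :
    ∃ r, Odd (P.rootMultiplicity r) := by
  obtain ⟨q, -, hdeg, hq⟩ := exists_prod_multiset_X_sub_C_mul P
  have hq' : Even q.natDegree := by
    by_contra hodd
    obtain ⟨x, hx⟩ := exists_isRoot_of_odd_natDegree (Nat.not_even_iff_odd.1 hodd)
    have hq0 : q ≠ 0 := by rintro rfl; simp at hodd
    have := (mem_roots hq0).2 hx
    rw [hq] at this
    simp at this
  have hcard : Odd P.roots.card := by
    rw [← hdeg] at h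
    exact (Nat.odd_add.1 h).2 hq'
  by_contra! hall
  simp only [Nat.not_odd_iff_even] at hall
  rw [← Multiset.toFinset_sum_count_eq] at hcard
  refine Nat.not_even_iff_odd.2 hcard (Finset.even_sum _ fun r _ => ?_)
  rw [count_roots]; exact hall r

/-- `r ≠ 0` is a simple root of `X ^ m - r ^ m`, the derivative there being nonzero. -/
theorem rootMultiplicity_X_pow_sub_C_pow_le {r : ℝ} (hr : r ≠ 0) {m : ℕ} (hm : 0 < m) (k : ℕ) :
    ((X ^ m - C (r ^ m)) ^ k : ℝ[X]).rootMultiplicity r ≤ k := by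
  have hne : (X ^ m - C (r ^ m) : ℝ[X]) ≠ 0 := X_pow_sub_C_ne_zero hm _
  have h1 : (X ^ m - C (r ^ m) : ℝ[X]).rootMultiplicity r ≤ 1 := by
    by_contra! hlt
    have := (one_lt_rootMultiplicity_iff_isRoot_iterate_derivative hne).1 hlt 1 le_rfl
    simp [-map_pow, derivative_X_pow, hr, hm.ne'] at this
  induction k with
  | zero => simp
  | succ k ih =>
    rw [pow_succ, rootMultiplicity_mul (mul_ne_zero (pow_ne_zero _ hne) hne)]
    omega

/-- If all exponents lie in one class modulo `m`, then `P = X ^ d * Q(X ^ m)`. The multiplicity of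
`r ≠ 0` is at most that of `r ^ m` in `Q`, hence at most `deg Q ≤ n / m`. -/
theorem mul_rootMultiplicity_le {P : ℝ[X]} {m : ℕ} (hm : 0 < m)
    (hP : ∀ j, P.coeff j ≠ 0 → j ≡ P.natDegree [MOD m]) {r : ℝ} (hr : r ≠ 0) :
    m * P.rootMultiplicity r ≤ P.natDegree := by
  rcases eq_or_ne P 0 with rfl | hP0
  · simp
  set n := P.natDegree
  set d := n % m
  let Q : ℝ[X] := ∑ i ∈ Finset.range (n / m + 1), C (P.coeff (d + m * i)) * X ^ i
  have hQc : ∀ i, Q.coeff i = if i < n / m + 1 then P.coeff (d + m * i) else 0 := by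
    intro i; simp [Q, coeff_X_pow]
  have hn : d + m * (n / m) = n := Nat.mod_add_div n m
  have hPQ : P = X ^ d * expand ℝ m Q := by
    ext k
    rw [coeff_X_pow_mul']
    by_cases hk : P.coeff k = 0
    · rw [hk]
      split_ifs with h1
      · rw [coeff_expand hm]
        split_ifs with h2
        · rw [hQc]
          split_ifs with h3
          · rw [Nat.mul_div_cancel' h2, Nat.add_sub_cancel' h1, hk]
          · rfl
        · rfl
      · rfl
    · have hkn : k ≤ n := le_natDegree_of_ne_zero hk
      have hmod : k % m = d := hP k hk
      have hk' : d + m * (k / m) = k := by rw [← hmod]; exact Nat.mod_add_div k m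
      have hsub : k - d = m * (k / m) := by omega
      rw [if_pos (by omega), coeff_expand hm, hsub, if_pos (dvd_mul_right _ _),
        Nat.mul_div_cancel_left _ hm, hQc, if_pos (Nat.lt_succ_of_le (Nat.div_le_div_right hkn)), hk']
  have hQ0 : Q ≠ 0 := by
    intro h; rw [h] at hPQ; simp at hPQ; exact hP0 hPQ
  have hQdeg : Q.natDegree ≤ n / m := by
    rw [natDegree_le_iff_coeff_eq_zero]
    intro i hi
    rw [hQc, if_neg (by omega)]
  obtain ⟨Q₁, hQ₁, hnd⟩ := exists_eq_pow_rootMultiplicity_mul_and_not_dvd Q hQ0 (r ^ m)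
  set k := Q.rootMultiplicity (r ^ m)
  have hk : k ≤ n / m := by
    refine le_trans ?_ hQdeg
    change Q.rootMultiplicity (r ^ m) ≤ _
    rw [← count_roots]
    exact (Multiset.count_le_card _ _).trans (card_roots' Q)
  have hexp : expand ℝ m Q = (X ^ m - C (r ^ m)) ^ k * expand ℝ m Q₁ := by
    conv_lhs => rw [hQ₁]
    simp
  have h1 : P = X ^ d * ((X ^ m - C (r ^ m)) ^ k * expand ℝ m Q₁) := by rw [← hexp, ← hPQ]
  have hne : X ^ d * ((X ^ m - C (r ^ m)) ^ k * expand ℝ m Q₁) ≠ 0 := h1 ▸ hP0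
  have h2 : (X ^ d : ℝ[X]).rootMultiplicity r = 0 :=
    rootMultiplicity_eq_zero (by simp [hr])
  have h3 : (expand ℝ m Q₁).rootMultiplicity r = 0 := by
    refine rootMultiplicity_eq_zero ?_
    rw [dvd_iff_isRoot] at hnd
    simpa [expand_eval] using hnd
  have h4 : P.rootMultiplicity r ≤ k := by
    rw [h1, rootMultiplicity_mul hne, rootMultiplicity_mul (right_ne_zero_of_mul hne), h2, h3]
    simpa using rootMultiplicity_X_pow_sub_C_pow_le hr hm k
  calc m * P.rootMultiplicity r ≤ m * (n / m) := by gcongr; omega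
    _ ≤ n := Nat.mul_div_le n m

theorem mul_factorial_dvd {m a e n : ℕ} (hae : a < e) (hen : e ≤ n) (hme : m ∣ e) :
    m * a.factorial ∣ n.factorial := by
  refine dvd_trans ?_ (Nat.factorial_dvd_factorial hen)
  obtain ⟨e, rfl⟩ : ∃ e', e = e' + 1 := ⟨e - 1, by omega⟩
  rw [Nat.factorial_succ]
  exact mul_dvd_mul hme (Nat.factorial_dvd_factorial (by omega))

/-- This is the induction step for the denominator `n!`. It suffices to find a multiple of `m`
strictly above the multiplicity `a` and at most `n = deg P`: for `r ≠ 0` and `m > 1` the number `m *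
a` serves. -/
theorem mul_factorial_rootMultiplicity_dvd {P : ℝ[X]} (hP0 : P ≠ 0) {m : ℕ} (hm : 0 < m)
    (hP : ∀ j, P.coeff j ≠ 0 → j ≡ P.natDegree [MOD m]) {r : ℝ}
    (hpos : 0 < P.rootMultiplicity r) (hlt : P.rootMultiplicity r < P.natDegree) :
    m * (P.rootMultiplicity r).factorial ∣ P.natDegree.factorial := by
  rcases eq_or_ne m 1 with rfl | hm1
  · exact mul_factorial_dvd hlt le_rfl (one_dvd _)
  rcases eq_or_ne r 0 with rfl | hr
  · rw [rootMultiplicity_eq_natTrailingDegree'] at hlt ⊢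
    have h1 := hP P.natTrailingDegree (by
      rw [← trailingCoeff]; exact trailingCoeff_nonzero_iff_nonzero.2 hP0)
    have h2 : m ∣ P.natDegree - P.natTrailingDegree := (Nat.modEq_iff_dvd' hlt.le).1 h1
    have h3 := Nat.le_of_dvd (by omega) h2
    -- At `r = 0` the multiplicity is the lowest exponent. It is congruent to the degree `n` modulo
    -- `m`, so it is at most `n - m`, which lies below the largest multiple of `m` not exceeding
    -- `n`.
    refine mul_factorial_dvd (e := m * (P.natDegree / m)) ?_ (Nat.mul_div_le _ _) (dvd_mul_right _ _)
    have := Nat.mod_add_div P.natDegree m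
    have := Nat.mod_lt P.natDegree hm
    omega
  · refine mul_factorial_dvd ?_ (mul_rootMultiplicity_le hm hP hr) (dvd_mul_right _ _)
    exact lt_mul_of_one_lt_left hpos (by omega)

end RealPolynomial

end Subharmonic

end

noncomputable section

namespace Subharmonic

open Filter Topology

attribute [fun_prop] analyticAt_fst analyticAt_snd

/-! ### Newton polygons and real Puiseux branches -/

section NewtonPuiseux

theorem exists_analytic_implicit {E₁ E₂ F : Type*}
    [NormedAddCommGroup E₁] [NormedSpace ℝ E₁] [CompleteSpace E₁]
    [NormedAddCommGroup E₂] [NormedSpace ℝ E₂] [CompleteSpace E₂]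
    [NormedAddCommGroup F] [NormedSpace ℝ F] [CompleteSpace F]
    {f : E₁ × E₂ → F} {u : E₁ × E₂} (hf : AnalyticAt ℝ f u)
    (hinv : (fderiv ℝ f u ∘L .inr ℝ E₁ E₂).IsInvertible) :
    ∃ ψ : E₁ → E₂, AnalyticAt ℝ ψ u.1 ∧ ψ u.1 = u.2 ∧ (∀ᶠ x in 𝓝 u.1, f (x, ψ x) = f u) ∧
      ∀ᶠ v in 𝓝 u, f v = f u ↔ ψ v.1 = v.2 := by
  -- In `WithTop ℕ∞` the element `⊤` is the analytic class, so the implicit function obtained below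
  -- is analytic.
  have cdf : ContDiffAt ℝ ⊤ f u := hf.contDiffAt
  have h0 : (⊤ : WithTop ℕ∞) ≠ 0 := by simp
  exact ⟨cdf.implicitFunction h0 hinv,
    (cdf.contDiffAt_implicitFunction h0 hinv).analyticAt,
    cdf.implicitFunction_apply_self h0 hinv, cdf.eventually_apply_implicitFunction h0 hinv,
    cdf.eventually_apply_eq_iff_implicitFunction h0 hinv⟩

theorem isInvertible_of_apply_one_ne_zero {L : ℝ →L[ℝ] ℝ} (h : L 1 ≠ 0) : L.IsInvertible := by
  refine ⟨ContinuousLinearEquiv.unitsEquivAut ℝ (Units.mk0 _ h), ?_⟩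
  ext; simp

/-- Shifting the second variable along an analytic curve, the subleading coefficient of an analytic
function of order `k + 1` in that variable can be made to vanish. -/
theorem exists_tschirnhaus {g : ℝ × ℝ → ℝ} (hg : AnalyticAt ℝ g 0) {k : ℕ}
    (hord : analyticOrderAt (fun x => g (0, x)) 0 = (k + 1 : ℕ)) :
    ∃ (ξ : ℝ → ℝ) (a : ℕ → ℝ → ℝ) (h : ℝ × ℝ → ℝ), AnalyticAt ℝ ξ 0 ∧ ξ 0 = 0 ∧
      (∀ j, AnalyticAt ℝ (a j) 0) ∧ (∀ j < k, a j 0 = 0) ∧ AnalyticAt ℝ h 0 ∧ h 0 ≠ 0 ∧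
      ∀ᶠ v in 𝓝 (0 : ℝ × ℝ),
        g (v.1, ξ v.1 + v.2) = ∑ j ∈ Finset.range k, a j v.1 * v.2 ^ j + v.2 ^ (k + 1) * h v := by
  let g₀ : ℝ → ℝ := fun x => g (0, x)
  have hg₀ : AnalyticAt ℝ g₀ 0 :=
    hg.comp_of_eq (f := fun x : ℝ => ((0 : ℝ), x)) (analyticAt_const.prod analyticAt_id) rfl
  obtain ⟨hz, hnz⟩ := (analyticOrderAt_eq_nat_iff_iteratedDeriv_eq_zero hg₀).1 hord
  -- Expand `g(s, x + y)` in powers of `y`. The coefficient `A k` of `y ^ k` has nonzero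
  -- `x`-derivative `g₀⁽ᵏ⁺¹⁾(0) / k!` at the origin, so `A k (s, x) = 0` is solved by an analytic `x
  -- = ξ s`.
  let f : (ℝ × ℝ) × ℝ → ℝ := fun w => g (w.1.1, w.1.2 + w.2)
  have hf : AnalyticAt ℝ f (0, 0) := by
    refine AnalyticAt.comp_of_eq (f := fun w : (ℝ × ℝ) × ℝ => (w.1.1, w.1.2 + w.2)) hg ?_ ?_
    · fun_prop
    · simp
  obtain ⟨A, h, hA, hh, hE⟩ := exists_fiber_taylor hf (k + 2)
  have hAt : ∀ᶠ w in 𝓝 (0 : ℝ × ℝ), ∀ j < k + 2,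
      A j w = taylorCoeff j (fun y => g (w.1, w.2 + y)) := by
    have hh' : ∀ᶠ w in 𝓝 (0 : ℝ × ℝ), AnalyticAt ℝ h (w, 0) :=
      (Continuous.prodMk continuous_id continuous_const).continuousAt.eventually
        (f := fun w : ℝ × ℝ => (w, (0 : ℝ))) hh.eventually_analyticAt
    filter_upwards [(Filter.Eventually.curry_nhds hE), hh'] with w hw hw' j hj
    refine (taylorCoeff_of_eventuallyEq (h := fun y => h (w, y)) (c := fun j => A j w)
      (hw'.comp_of_eq (f := fun y => (w, y)) (analyticAt_const.prod analyticAt_id) rfl)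
      hw hj).symm
  have hA0 : ∀ j < k + 2, A j 0 = iteratedDeriv j g₀ 0 / j.factorial := by
    intro j hj
    have := hAt.self_of_nhds j hj
    simpa [taylorCoeff, g₀] using this
  have hAk : ∀ᶠ x in 𝓝 (0 : ℝ), A k (0, x) = iteratedDeriv k g₀ x / k.factorial := by
    have hc : ContinuousAt (fun x : ℝ => ((0 : ℝ), x)) 0 := by fun_prop
    filter_upwards [hc.eventually hAt] with x hx
    rw [hx k (by omega), taylorCoeff]
    congr 1
    have := congrFun (iteratedDeriv_comp_const_add k g₀ x) 0
    simpa [g₀] using this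
  have hder : HasDerivAt (fun x => A k (0, x)) (iteratedDeriv (k + 1) g₀ 0 / k.factorial) 0 := by
    have h1 : HasDerivAt (iteratedDeriv k g₀) (iteratedDeriv (k + 1) g₀ 0) 0 := by
      rw [iteratedDeriv_succ]
      rw [iteratedDeriv_eq_iterate]
      exact (AnalyticAt.iterated_deriv hg₀ k).differentiableAt.hasDerivAt
    exact (h1.div_const _).congr_of_eventuallyEq hAk
  have hinv : (fderiv ℝ (A k) 0 ∘L .inr ℝ ℝ ℝ).IsInvertible := by
    apply isInvertible_of_apply_one_ne_zero
    have h1 : HasDerivAt (fun x : ℝ => A k (0, x)) (fderiv ℝ (A k) 0 (0, 1)) 0 :=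
      (hA k).differentiableAt.hasFDerivAt.comp_hasDerivAt_of_eq (f := fun x : ℝ => ((0 : ℝ), x)) 0
        ((hasDerivAt_const _ _).prodMk (hasDerivAt_id _)) rfl
    simp only [ContinuousLinearMap.comp_apply, ContinuousLinearMap.inr_apply]
    rw [h1.unique hder]
    exact div_ne_zero hnz (by positivity)
  have hAk0 : A k 0 = 0 := by rw [hA0 k (by omega), hz k (by omega), zero_div]
  obtain ⟨ξ, hξ, hξ0, hξe, -⟩ := exists_analytic_implicit (hA k) hinv
  simp only [Prod.fst_zero, Prod.snd_zero] at hξ hξ0 hξe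
  have hc1 : AnalyticAt ℝ (fun s : ℝ => (s, ξ s)) 0 := analyticAt_id.prod hξ
  have hc1' : ((0 : ℝ), ξ 0) = 0 := by rw [hξ0]; rfl
  have hc2 : AnalyticAt ℝ (fun v : ℝ × ℝ => ((v.1, ξ v.1), v.2)) 0 :=
    (hc1.comp_of_eq analyticAt_fst rfl).prod analyticAt_snd
  have hc2' : (((0 : ℝ × ℝ).1, ξ (0 : ℝ × ℝ).1), (0 : ℝ × ℝ).2) = ((0 : ℝ × ℝ), (0 : ℝ)) := by
    simp only [Prod.fst_zero, Prod.snd_zero, hc1']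
  refine ⟨ξ, fun j s => A j (s, ξ s),
    fun v => A (k + 1) (v.1, ξ v.1) + v.2 * h ((v.1, ξ v.1), v.2), hξ, hξ0, ?_, ?_, ?_, ?_, ?_⟩
  · intro j
    exact (hA j).comp_of_eq hc1 hc1'
  · intro j hj
    simp only [hc1']
    rw [hA0 j (by omega), hz j (by omega), zero_div]
  · refine AnalyticAt.fun_add ?_ (analyticAt_snd.fun_mul (hh.comp_of_eq hc2 hc2'))
    exact ((hA (k + 1)).comp_of_eq hc1 hc1').comp_of_eq
      (f := fun v : ℝ × ℝ => v.1) analyticAt_fst rfl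
  · simp only [Prod.fst_zero, Prod.snd_zero, hc1', zero_mul, add_zero]
    rw [hA0 _ (by omega)]
    exact div_ne_zero hnz (by positivity)
  · have hfst : Tendsto (fun v : ℝ × ℝ => v.1) (𝓝 0) (𝓝 0) := continuous_fst.tendsto _
    have htend := hc2.continuousAt.tendsto
    rw [hc2'] at htend
    filter_upwards [htend.eventually hE, hfst.eventually hξe] with v hv1 hv2
    simp only [f] at hv1
    rw [hv1, Finset.sum_range_succ, Finset.sum_range_succ, hv2, hAk0]
    ring

theorem analyticAt_comp_pow {f : ℝ → ℝ} (hf : AnalyticAt ℝ f 0) {m : ℕ} (hm : 0 < m) :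
    AnalyticAt ℝ (fun u : ℝ => f (u ^ m)) 0 :=
  hf.comp_of_eq (f := fun u : ℝ => u ^ m) (by fun_prop) (by simp [hm.ne'])

theorem tendsto_pow_nhds_zero {m : ℕ} (hm : 0 < m) : Tendsto (fun u : ℝ => u ^ m) (𝓝 0) (𝓝 0) := by
  have : Continuous fun u : ℝ => u ^ m := by fun_prop
  simpa [hm.ne'] using this.tendsto 0

/-- The first edge of the Newton polygon. -/
theorem exists_newton_edge {k : ℕ} {a : ℕ → ℝ → ℝ} (ha : ∀ j, AnalyticAt ℝ (a j) 0)
    (ha0 : ∀ j < k, a j 0 = 0) (hex : ∃ j < k, ¬ ∀ᶠ s in 𝓝 0, a j s = 0) :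
    ∃ (m l : ℕ) (c : ℕ → ℝ → ℝ), 0 < m ∧ 0 < l ∧ (∀ j, AnalyticAt ℝ (c j) 0) ∧
      (∀ᶠ u in 𝓝 0, ∀ j < k, a j (u ^ m) = u ^ (l * (k + 1 - j)) * c j u) ∧
      (∀ j < k, c j 0 ≠ 0 → j ≡ k + 1 [MOD m]) ∧ ∃ j < k, c j 0 ≠ 0 := by
  classical
  let J := (Finset.range k).filter fun j => ¬ ∀ᶠ s in 𝓝 0, a j s = 0
  have hJ : ∀ j, j ∈ J ↔ j < k ∧ ¬ ∀ᶠ s in 𝓝 0, a j s = 0 := by simp [J]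
  have hJne : J.Nonempty := by
    obtain ⟨j, hj⟩ := hex
    exact ⟨j, (hJ j).2 hj⟩
  let o : ℕ → ℕ := fun j => analyticOrderNatAt (a j) 0
  have ho : ∀ j ∈ J, ∃ b : ℝ → ℝ, AnalyticAt ℝ b 0 ∧ b 0 ≠ 0 ∧
      ∀ᶠ s in 𝓝 0, a j s = s ^ o j * b s := by
    intro j hj
    have htop : analyticOrderAt (a j) 0 ≠ ⊤ := by
      rw [Ne, analyticOrderAt_eq_top]; exact ((hJ j).1 hj).2
    simpa using ((ha j).analyticOrderAt_eq_natCast).1 (Nat.cast_analyticOrderNatAt htop).symm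
  have hopos : ∀ j ∈ J, 0 < o j := by
    intro j hj
    obtain ⟨b, -, hb0, hb⟩ := ho j hj
    by_contra! hc
    have h1 := hb.self_of_nhds
    rw [ha0 j ((hJ j).1 hj).1, Nat.le_zero.1 hc] at h1
    simp at h1
    exact hb0 h1.symm
  choose! b hb hb0 hab using ho
  -- The edge starts at the vertex of `x ^ (k + 1)`; its slope `l / m`, in lowest terms, is the
  -- least value of `o j / (k + 1 - j)`.
  obtain ⟨i, hi, hmin⟩ := J.exists_min_image (fun j => (o j : ℚ) / ((k + 1 - j : ℕ) : ℚ)) hJne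
  have hik := ((hJ i).1 hi).1
  have hio := hopos i hi
  obtain ⟨d, hd⟩ : ∃ d, d = Nat.gcd (o i) (k + 1 - i) := ⟨_, rfl⟩
  have hdpos : 0 < d := by rw [hd]; exact Nat.gcd_pos_of_pos_left _ hio
  obtain ⟨l, hl⟩ : d ∣ o i := by rw [hd]; exact Nat.gcd_dvd_left _ _
  obtain ⟨m, hm⟩ : d ∣ k + 1 - i := by rw [hd]; exact Nat.gcd_dvd_right _ _
  have hcop : Nat.Coprime m l := by
    have h1 := Nat.coprime_div_gcd_div_gcd (m := o i) (n := k + 1 - i) (hd ▸ hdpos)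
    rw [← hd, hl, hm, Nat.mul_div_cancel_left _ hdpos, Nat.mul_div_cancel_left _ hdpos] at h1
    exact h1.symm
  have hlpos : 0 < l := Nat.pos_of_ne_zero fun h => by simp [h] at hl; omega
  have hmpos : 0 < m := Nat.pos_of_ne_zero fun h => by simp [h] at hm; omega
  have hle : ∀ j ∈ J, l * (k + 1 - j) ≤ o j * m := by
    intro j hj
    have hjk := ((hJ j).1 hj).1
    have h1 := hmin j hj
    rw [div_le_div_iff₀ (by exact_mod_cast (by omega : 0 < k + 1 - i))
      (by exact_mod_cast (by omega : 0 < k + 1 - j))] at h1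
    have h2 : o i * (k + 1 - j) ≤ o j * (k + 1 - i) := by exact_mod_cast h1
    rw [hl, hm, mul_assoc, mul_left_comm (o j)] at h2
    exact Nat.le_of_mul_le_mul_left h2 hdpos
  -- By `hle` the truncated subtraction in the exponent is exact. The exponent is zero precisely for
  -- the points on the edge.
  refine ⟨m, l, fun j u => if j ∈ J then u ^ (o j * m - l * (k + 1 - j)) * b j (u ^ m) else 0,
    hmpos, hlpos, ?_, ?_, ?_, i, hik, ?_⟩
  · intro j
    by_cases hj : j ∈ J
    · simp only [hj, if_true]
      exact AnalyticAt.fun_mul (by fun_prop) (analyticAt_comp_pow (hb j hj) hmpos)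
    · simp only [hj, if_false]; exact analyticAt_const
  · simp only [← Finset.mem_range (n := k)]
    rw [Filter.eventually_all_finset]
    intro j hjk
    rw [Finset.mem_range] at hjk
    by_cases hj : j ∈ J
    · simp only [hj, if_true]
      filter_upwards [(tendsto_pow_nhds_zero hmpos).eventually (hab j hj)] with u hu
      rw [hu, ← mul_assoc, ← pow_add, Nat.add_sub_cancel' (hle j hj), ← pow_mul, mul_comm m]
    · simp only [hj, if_false]
      have : ∀ᶠ s in 𝓝 0, a j s = 0 := by
        by_contra hc; exact hj ((hJ j).2 ⟨hjk, hc⟩)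
      filter_upwards [(tendsto_pow_nhds_zero hmpos).eventually this] with u hu
      simp [hu]
  · intro j hjk hc
    by_cases hj : j ∈ J
    · simp only [hj, if_true] at hc
      have h1 : o j * m - l * (k + 1 - j) = 0 := by
        by_contra h; simp [h] at hc
      -- On the edge `o j * m = l * (k + 1 - j)`, and `m`, `l` are coprime, so `m` divides `k + 1 -
      -- j`.
      have h2 := hle j hj
      have h3 : m ∣ l * (k + 1 - j) := ⟨o j, by rw [mul_comm m]; omega⟩
      exact (Nat.modEq_iff_dvd' (by omega)).2 (hcop.dvd_of_dvd_mul_left h3)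
    · simp [hj] at hc
  · simp only [hi, if_true]
    have : o i * m - l * (k + 1 - i) = 0 := by
      rw [hl, hm]
      have : d * l * m = l * (d * m) := by ring
      omega
    simp [this, hmpos.ne', hb0 i hi]

open Polynomial in
theorem analyticOrderAt_eval_add {P : ℝ[X]} (hP : P ≠ 0) (r : ℝ) :
    analyticOrderAt (fun y => P.eval (r + y)) 0 = (P.rootMultiplicity r : ℕ) := by
  obtain ⟨q, hq, hnd⟩ := exists_eq_pow_rootMultiplicity_mul_and_not_dvd P hP r
  have han : ∀ Q : ℝ[X], AnalyticAt ℝ (fun y => Q.eval (r + y)) 0 := fun Q => by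
    simpa using AnalyticAt.aeval_polynomial (f := fun y : ℝ => r + y) (z := 0) (by fun_prop) Q
  refine ((han P).analyticOrderAt_eq_natCast).2 ⟨fun y => q.eval (r + y), han q, ?_, ?_⟩
  · rw [dvd_iff_isRoot] at hnd; simpa using hnd
  · refine Eventually.of_forall fun y => ?_
    conv_lhs => rw [hq]
    simp

-- This makes the order drop. A root of full multiplicity would give `P = c (X - r) ^ (k + 1)`; the
-- missing coefficient of `X ^ k` forces `r = 0`, and then `P` would be a monomial.
open Polynomial in
theorem rootMultiplicity_lt_of_coeff_eq_zero {P : ℝ[X]} {k : ℕ} (hdeg : P.natDegree = k + 1)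
    (hk : P.coeff k = 0) (hex : ∃ j < k, P.coeff j ≠ 0) (r : ℝ) :
    P.rootMultiplicity r < k + 1 := by
  have hP : P ≠ 0 := by rintro rfl; simp at hdeg
  by_contra! hc
  obtain ⟨q, hq⟩ := (le_rootMultiplicity_iff hP).1 hc
  have hq0 : q ≠ 0 := by rintro rfl; simp at hq; exact hP hq
  have h1 := congrArg natDegree hq
  rw [natDegree_mul (pow_ne_zero _ (X_sub_C_ne_zero r)) hq0, natDegree_pow, natDegree_X_sub_C,
    hdeg] at h1
  obtain ⟨c, rfl⟩ := natDegree_eq_zero.1 (show q.natDegree = 0 by omega)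
  have hc0 : c ≠ 0 := by rintro rfl; simp at hq0
  rw [hq, coeff_mul_C, sub_eq_add_neg, ← C_neg, coeff_X_add_C_pow] at hk
  have hr : r = 0 := by
    have : (k : ℝ) + 1 ≠ 0 := by positivity
    simpa [hc0, this] using hk
  obtain ⟨j, hj, hj0⟩ := hex
  rw [hq, hr] at hj0
  simp [coeff_X_pow] at hj0
  omega

open Polynomial in
/-- **Newton–Puiseux** for real roots: an analytic function of two variables whose order in the
second one is odd has a real branch of zeros which is a convergent power series in a fractional
power of the first variable, with denominator dividing `n!`. -/
theorem exists_puiseux_root (n : ℕ) : Odd n → ∀ g : ℝ × ℝ → ℝ, AnalyticAt ℝ g 0 →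
    analyticOrderAt (fun x => g (0, x)) 0 = n →
    ∃ (N : ℕ) (φ : ℝ → ℝ), 0 < N ∧ N ∣ n.factorial ∧ AnalyticAt ℝ φ 0 ∧ φ 0 = 0 ∧
      ∀ᶠ v in 𝓝 0, g (v ^ N, φ v) = 0 := by
  induction n using Nat.strong_induction_on with
  | _ n ih =>
  intro hn g hg hord
  obtain ⟨k, rfl⟩ : ∃ k, n = k + 1 := ⟨n - 1, by have := hn.pos; omega⟩
  obtain ⟨ξ, a, h, hξ, hξ0, ha, ha0, hh, hh0, hE⟩ := exists_tschirnhaus hg hord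
  by_cases hex : ∃ j < k, ¬ ∀ᶠ s in 𝓝 0, a j s = 0
  · obtain ⟨m, l, c, hm, hl, hc, hac, hmod, j₀, hj₀, hcj₀⟩ := exists_newton_edge ha ha0 hex
    -- The polynomial of the edge: the leading part of `g` after substituting `s = u ^ m` and `x = ξ
    -- s + u ^ l * X`.
    let P : ℝ[X] := C (h 0) * X ^ (k + 1) + ∑ j ∈ Finset.range k, C (c j 0) * X ^ j
    have hcoeff : ∀ j, P.coeff j = (if j = k + 1 then h 0 else 0) + if j < k then c j 0 else 0 := by
      intro j; simp [P, coeff_X_pow]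
    have hdeg : P.natDegree = k + 1 := by
      refine natDegree_eq_of_le_of_coeff_ne_zero ?_ ?_
      · rw [natDegree_le_iff_coeff_eq_zero]
        intro j hj
        rw [hcoeff, if_neg (by omega), if_neg (by omega), add_zero]
      · rw [hcoeff, if_pos rfl, if_neg (by omega), add_zero]; exact hh0
    have hP0 : P ≠ 0 := by rintro h; simp [h] at hdeg
    obtain ⟨r, hr⟩ := exists_odd_rootMultiplicity (P := P) (by rwa [hdeg])
    have hlt : P.rootMultiplicity r < k + 1 := by
      refine rootMultiplicity_lt_of_coeff_eq_zero hdeg ?_ ⟨j₀, hj₀, ?_⟩ r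
      · simp [hcoeff]
      · rw [hcoeff, if_neg (by omega), if_pos hj₀, zero_add]; exact hcj₀
    have hdvd := mul_factorial_rootMultiplicity_dvd hP0 hm (r := r) (fun j hj => by
      rw [hdeg]
      rw [hcoeff] at hj
      by_cases h1 : j = k + 1
      · rw [h1]
      · by_cases h2 : j < k
        · exact hmod j h2 (by simpa [h1, h2] using hj)
        · simp [h1, h2] at hj) hr.pos (by rwa [hdeg])
    rw [hdeg] at hdvd
    -- Blow-up at the root `r`: with `s = u ^ m` and `x = ξ s + u ^ l * (r + y)` one has `g = u ^ (l
    -- * (k + 1)) * g' (u, y)`. Since `g' (0, y) = P (r + y)`, the new order is the multiplicity of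
    -- `r`.
    let g' : ℝ × ℝ → ℝ := fun w => ∑ j ∈ Finset.range k, c j w.1 * (r + w.2) ^ j +
      (r + w.2) ^ (k + 1) * h (w.1 ^ m, w.1 ^ l * (r + w.2))
    have hg' : AnalyticAt ℝ g' 0 := by
      have h1 : ∀ j, AnalyticAt ℝ (fun w : ℝ × ℝ => c j w.1) 0 := fun j =>
        (hc j).comp_of_eq (f := fun w : ℝ × ℝ => w.1) analyticAt_fst rfl
      have h2 : AnalyticAt ℝ (fun w : ℝ × ℝ => h (w.1 ^ m, w.1 ^ l * (r + w.2))) 0 :=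
        hh.comp_of_eq (f := fun w : ℝ × ℝ => (w.1 ^ m, w.1 ^ l * (r + w.2))) (by fun_prop)
          (by simp [hm.ne', hl.ne'])
      refine AnalyticAt.fun_add (Finset.analyticAt_fun_sum _ fun j _ => ?_) ?_
      · exact (h1 j).fun_mul (by fun_prop)
      · exact AnalyticAt.fun_mul (by fun_prop) h2
    have hord' : analyticOrderAt (fun x => g' (0, x)) 0 = (P.rootMultiplicity r : ℕ) := by
      rw [← analyticOrderAt_eval_add hP0 r]
      congr 1
      ext y
      have : (((0 : ℝ) ^ m, (0 : ℝ) ^ l * (r + y)) : ℝ × ℝ) = 0 := by simp [hm.ne', hl.ne']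
      simp only [g', this]
      simp [P, eval_finsetSum]
      ring
    obtain ⟨N, φ, hN, hNd, hφ, hφ0, hφe⟩ := ih _ hlt hr g' hg' hord'
    have hmN : 0 < m * N := Nat.mul_pos hm hN
    -- The induction hypothesis parametrizes `u = v ^ N`, so denominators multiply.
    refine ⟨m * N, fun v => ξ (v ^ (m * N)) + v ^ (N * l) * (r + φ v), hmN,
      (Nat.mul_dvd_mul_left m hNd).trans hdvd, ?_, ?_, ?_⟩
    · exact (analyticAt_comp_pow hξ hmN).fun_add
        (AnalyticAt.fun_mul (by fun_prop) (analyticAt_const.fun_add hφ))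
    · simp [hmN.ne', hξ0, hN.ne', hl.ne']
    · have ht : Tendsto (fun v : ℝ => (v ^ (m * N), v ^ (N * l) * (r + φ v))) (𝓝 0)
          (𝓝 (0 : ℝ × ℝ)) := by
        have h1 : ContinuousAt (fun v : ℝ => (v ^ (m * N), v ^ (N * l) * (r + φ v))) 0 :=
          ContinuousAt.prodMk (by fun_prop)
            (ContinuousAt.mul (by fun_prop) (continuousAt_const.add hφ.continuousAt))
        have h3 : ((0 : ℝ) ^ (m * N), (0 : ℝ) ^ (N * l) * (r + φ 0)) = 0 := by
          simp [hmN.ne', (Nat.mul_pos hN hl).ne']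
        rw [← h3]
        exact h1.tendsto
      filter_upwards [ht.eventually hE, (tendsto_pow_nhds_zero hN).eventually hac, hφe]
        with v h1 h2 h3
      rw [h1]
      have hpow : v ^ (m * N) = (v ^ N) ^ m := by rw [← pow_mul, mul_comm]
      have hfac : ∑ j ∈ Finset.range k, a j (v ^ (m * N)) * (v ^ (N * l) * (r + φ v)) ^ j +
          (v ^ (N * l) * (r + φ v)) ^ (k + 1) * h (v ^ (m * N), v ^ (N * l) * (r + φ v)) =
          (v ^ N) ^ (l * (k + 1)) * g' (v ^ N, φ v) := by
        simp only [g']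
        rw [mul_add ((v ^ N) ^ (l * (k + 1))), Finset.mul_sum]
        congr 1
        · refine Finset.sum_congr rfl fun j hj => ?_
          have hj' := Finset.mem_range.1 hj
          rw [hpow, h2 j hj', pow_mul v N l, mul_pow, ← pow_mul (v ^ N) l j]
          have : l * (k + 1) = l * (k + 1 - j) + l * j := by
            rw [← mul_add]; congr 1; omega
          rw [this, pow_add]
          ring
        · rw [hpow, pow_mul v N l, mul_pow, ← pow_mul (v ^ N) l (k + 1)]
          ring_nf
      rw [hfac, h3, mul_zero]
  · push Not at hex
    -- All lower coefficients vanish identically, so `x = ξ s` is itself a branch. The case `n = 1`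
    -- ends here.
    refine ⟨1, ξ, one_pos, one_dvd _, hξ, hξ0, ?_⟩
    have hc : Tendsto (fun s : ℝ => (s, (0 : ℝ))) (𝓝 0) (𝓝 (0 : ℝ × ℝ)) :=
      Continuous.tendsto' (by fun_prop) _ _ rfl
    have hall : ∀ᶠ s in 𝓝 (0 : ℝ), ∀ j ∈ Finset.range k, a j s = 0 := by
      rw [Filter.eventually_all_finset]
      exact fun j hj => hex j (Finset.mem_range.1 hj)
    filter_upwards [hc.eventually hE, hall] with s h1 h2
    simp only [add_zero] at h1
    rw [pow_one, h1, Finset.sum_eq_zero fun j hj => by rw [h2 j hj, zero_mul]]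
    simp

end NewtonPuiseux

end Subharmonic

end

noncomputable section

namespace Subharmonic

open Filter Topology MeasureTheory

/-! ### Means and zero-mean primitives of periodic functions -/

section PeriodicPrimitive

variable {T : ℝ} {f g : ℝ → ℝ}

theorem mean_add (hf : Continuous f) (hg : Continuous g) :
    mean T (fun t => f t + g t) = mean T f + mean T g := by
  rw [mean, mean, mean, intervalIntegral.integral_add (hf.intervalIntegrable _ _)
    (hg.intervalIntegrable _ _), mul_add]

theorem mean_const_mul (c : ℝ) : mean T (fun t => c * f t) = c * mean T f := by
  rw [mean, mean, intervalIntegral.integral_const_mul]; ring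

theorem mean_const (hT : 0 < T) (c : ℝ) : mean T (fun _ => c) = c := by
  rw [mean, intervalIntegral.integral_const, smul_eq_mul, sub_zero]
  field_simp

theorem mean_comp_sub (hf : Function.Periodic f T) (s : ℝ) :
    mean T (fun t => f (t - s)) = mean T f := by
  rw [mean, mean, intervalIntegral.integral_comp_sub_right (fun t => f t) s]
  have := hf.intervalIntegral_add_eq (0 - s) 0
  rw [show T - s = 0 - s + T by ring, this, zero_add]

theorem abs_mean_le (hT : 0 < T) {C : ℝ} (hC : ∀ t, |f t| ≤ C) : |mean T f| ≤ C := by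
  have := intervalIntegral.norm_integral_le_of_norm_le_const (a := 0) (b := T) (C := C) (f := f)
    fun x _ => hC x
  rw [sub_zero, abs_of_pos hT, Real.norm_eq_abs] at this
  rw [mean, abs_mul, abs_of_pos (by positivity : 0 < 1 / T)]
  calc 1 / T * |∫ t in (0 : ℝ)..T, f t| ≤ 1 / T * (C * T) := by gcongr
    _ = C := by field_simp

theorem hasDerivAt_primitive (hf : Continuous f) (t : ℝ) :
    HasDerivAt (primitive T f) (f t - mean T f) t := by
  have hc : Continuous fun s => f s - mean T f := by fun_prop
  exact (intervalIntegral.integral_hasDerivAt_right (hc.intervalIntegrable _ _)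
    (hc.stronglyMeasurableAtFilter _ _) hc.continuousAt).sub_const _

theorem continuous_primitive (hf : Continuous f) : Continuous (primitive T f) :=
  continuous_iff_continuousAt.2 fun t => (hasDerivAt_primitive hf t).continuousAt

theorem periodic_integral_sub_mean (hT : 0 < T) (hf : Continuous f) (hp : Function.Periodic f T) :
    Function.Periodic (fun t => ∫ s in (0 : ℝ)..t, (f s - mean T f)) T := by
  intro t
  have hc : Continuous fun s => f s - mean T f := by fun_prop
  have hp' : Function.Periodic (fun s => f s - mean T f) T := fun s => by simp [hp s]
  have h1 : ∫ s in t..(t + T), (f s - mean T f) = 0 := by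
    rw [hp'.intervalIntegral_add_eq t 0, zero_add, intervalIntegral.integral_sub
      (hf.intervalIntegrable _ _) (by simp), intervalIntegral.integral_const, mean, smul_eq_mul]
    field_simp; ring
  simp only
  rw [← intervalIntegral.integral_add_adjacent_intervals (hc.intervalIntegrable 0 t)
    (hc.intervalIntegrable t (t + T)), h1, add_zero]

theorem periodic_primitive (hT : 0 < T) (hf : Continuous f) (hp : Function.Periodic f T) :
    Function.Periodic (primitive T f) T := fun t => by
  have := periodic_integral_sub_mean hT hf hp t
  simp only at this
  rw [primitive, primitive, this]

theorem continuous_integral_sub_mean (hf : Continuous f) :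
    Continuous (fun t => ∫ s in (0 : ℝ)..t, (f s - mean T f)) := by
  have : (fun t => ∫ s in (0 : ℝ)..t, (f s - mean T f)) = fun t => primitive T f t +
      mean T (fun u => ∫ s in (0 : ℝ)..u, (f s - mean T f)) := by
    ext t; simp [primitive]
  rw [this]
  exact (continuous_primitive hf).add continuous_const

theorem primitive_add (hf : Continuous f) (hg : Continuous g) (t : ℝ) :
    primitive T (fun t => f t + g t) t = primitive T f t + primitive T g t := by
  have h : (fun t => ∫ s in (0 : ℝ)..t, (f s + g s - mean T fun t => f t + g t)) = fun t =>
      (∫ s in (0 : ℝ)..t, (f s - mean T f)) + ∫ s in (0 : ℝ)..t, (g s - mean T g) := by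
    ext t
    rw [mean_add hf hg, ← intervalIntegral.integral_add
      (Continuous.intervalIntegrable (by fun_prop) _ _)
      (Continuous.intervalIntegrable (by fun_prop) _ _)]
    congr 1; ext s; ring
  rw [primitive, h, mean_add (continuous_integral_sub_mean hf) (continuous_integral_sub_mean hg),
    congrFun h t, primitive, primitive]
  ring

theorem primitive_const_mul (c : ℝ) (t : ℝ) :
    primitive T (fun t => c * f t) t = c * primitive T f t := by
  have h : (fun t => ∫ s in (0 : ℝ)..t, (c * f s - mean T fun t => c * f t)) = fun t =>
      c * (∫ s in (0 : ℝ)..t, (f s - mean T f)) := by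
    ext t
    rw [mean_const_mul, ← intervalIntegral.integral_const_mul]
    congr 1; ext s; ring
  rw [primitive, congrFun h t, h, mean_const_mul, primitive]
  ring

/-- Moving the base point of the integral changes it by a constant, which the subtraction of the
mean removes. Translation invariance is what later turns a shift of phase into a shift of time. -/
theorem primitive_comp_sub (hT : 0 < T) (hf : Continuous f) (hp : Function.Periodic f T)
    (s t : ℝ) : primitive T (fun t => f (t - s)) t = primitive T f (t - s) := by
  set J : ℝ → ℝ := fun t => ∫ r in (0 : ℝ)..t, (f r - mean T f) with hJ
  have hJc : Continuous J := continuous_integral_sub_mean hf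
  have hJp : Function.Periodic J T := periodic_integral_sub_mean hT hf hp
  have h : (fun t => ∫ r in (0 : ℝ)..t, (f (r - s) - mean T fun t => f (t - s))) = fun t =>
      J (t - s) + -J (0 - s) := by
    ext t
    have hc : Continuous fun s => f s - mean T f := by fun_prop
    rw [mean_comp_sub hp, intervalIntegral.integral_comp_sub_right (fun r => f r - mean T f) s,
      ← sub_eq_add_neg, hJ]
    exact (intervalIntegral.integral_interval_sub_left (hc.intervalIntegrable _ _)
      (hc.intervalIntegrable _ _)).symm
  rw [primitive, h, mean_add (by fun_prop) continuous_const, mean_comp_sub hJp, mean_const hT,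
    congrFun h t, primitive]
  ring

theorem abs_primitive_le (hT : 0 < T) (hf : Continuous f) (hp : Function.Periodic f T) {C : ℝ}
    (hC : ∀ t, |f t| ≤ C) (t : ℝ) : |primitive T f t| ≤ 4 * T * C := by
  have hC0 : 0 ≤ C := (abs_nonneg _).trans (hC 0)
  have hm := abs_mean_le hT hC
  -- The integral is periodic, so one period gives the bound `2TC`; subtracting its mean doubles it.
  have h1 : ∀ t, |∫ s in (0 : ℝ)..t, (f s - mean T f)| ≤ 2 * T * C := by
    intro t
    obtain ⟨y, hy, hty⟩ := (periodic_integral_sub_mean hT hf hp).exists_mem_Ico₀ hT t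
    rw [hty]
    have h2 := intervalIntegral.norm_integral_le_of_norm_le_const (a := 0) (b := y) (C := 2 * C)
      (f := fun s => f s - mean T f) fun x _ => by
        rw [Real.norm_eq_abs]
        exact (abs_sub _ _).trans (by linarith [hC x])
    rw [sub_zero, abs_of_nonneg hy.1, Real.norm_eq_abs] at h2
    nlinarith [hy.2.le]
  have h2 := abs_mean_le hT h1
  rw [primitive]
  refine (abs_sub _ _).trans ?_
  linarith [h1 t]

end PeriodicPrimitive

/-! ### Continuous functions on the circle, unrolled to `[0, T]` and rolled back -/

section Circle

variable {T : ℝ} [hT : Fact (0 < T)]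

/-- The continuous function on the circle given by a continuous periodic function. -/
def circleMk (f : ℝ → ℝ) (hc : Continuous f) (hp : Function.Periodic f T) : C(AddCircle T, ℝ) :=
  ⟨hp.lift, continuous_coinduced_dom.2 hc⟩

omit hT in
theorem circle_ext {u v : C(AddCircle T, ℝ)} (h : ∀ t : ℝ, u t = v t) : u = v := by
  ext x
  induction x using QuotientAddGroup.induction_on with
  | H t => exact h t

theorem circle_norm_le {u : C(AddCircle T, ℝ)} {C : ℝ} (hC : 0 ≤ C) (h : ∀ t : ℝ, |u t| ≤ C) :
    ‖u‖ ≤ C := by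
  refine (ContinuousMap.norm_le _ hC).2 fun x => ?_
  induction x using QuotientAddGroup.induction_on with
  | H t => exact h t

theorem abs_circle_le (u : C(AddCircle T, ℝ)) (t : ℝ) : |u t| ≤ ‖u‖ := u.norm_coe_le_norm _

omit hT in
@[fun_prop]
theorem continuous_circle (u : C(AddCircle T, ℝ)) : Continuous fun t : ℝ => u t :=
  u.continuous.comp (AddCircle.continuous_mk' T)

omit hT in
theorem periodic_circle (u : C(AddCircle T, ℝ)) : Function.Periodic (fun t : ℝ => u t) T :=
  fun t => by simp

/-- The average over the circle. -/
def meanCLM : C(AddCircle T, ℝ) →L[ℝ] ℝ :=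
  LinearMap.mkContinuous
    { toFun := fun u => mean T fun t => u t
      map_add' := fun u v => mean_add (continuous_circle u) (continuous_circle v)
      map_smul' := fun c u => mean_const_mul c } 1 fun u => by
      rw [one_mul]; exact abs_mean_le hT.out (abs_circle_le u)

@[simp]
theorem meanCLM_apply (u : C(AddCircle T, ℝ)) : meanCLM u = mean T fun t => u t := rfl

/-- The zero-mean primitive on the circle. -/
def primitiveCLM : C(AddCircle T, ℝ) →L[ℝ] C(AddCircle T, ℝ) :=
  LinearMap.mkContinuous
    { toFun := fun u => circleMk (primitive T fun t => u t)
        (continuous_primitive (continuous_circle u))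
        (periodic_primitive hT.out (continuous_circle u) (periodic_circle u))
      map_add' := fun u v => circle_ext fun t =>
        primitive_add (continuous_circle u) (continuous_circle v) t
      map_smul' := fun c u => circle_ext fun t => primitive_const_mul c t } (4 * T) fun u => by
      have := hT.out
      exact circle_norm_le (by positivity) fun t => abs_primitive_le hT.out (continuous_circle u)
        (periodic_circle u) (abs_circle_le u) t

/-- Restriction of functions on the circle to a fundamental interval. -/
def unrollCLM : C(AddCircle T, ℝ) →L[ℝ] C(Set.Icc (0 : ℝ) T, ℝ) :=
  LinearMap.mkContinuous
    { toFun := fun u => ⟨fun t => u (t : ℝ), by fun_prop⟩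
      map_add' := fun u v => rfl
      map_smul' := fun c u => rfl } 1 fun u => by
      rw [one_mul]
      exact (ContinuousMap.norm_le _ (norm_nonneg _)).2 fun t => u.norm_coe_le_norm _

@[simp]
theorem unrollCLM_apply (u : C(AddCircle T, ℝ)) (t : Set.Icc (0 : ℝ) T) :
    unrollCLM u t = u (t : ℝ) := rfl

/-- The function `t ↦ c t - (t / T) (c T - c 0)`, which takes equal values at `0` and `T`. -/
def closeUp (c : C(Set.Icc (0 : ℝ) T, ℝ)) (t : ℝ) : ℝ :=
  c (Set.projIcc 0 T hT.out.le t) -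
    t / T * (c ⟨T, hT.out.le, le_rfl⟩ - c ⟨0, le_rfl, hT.out.le⟩)

theorem closeUp_zero (c : C(Set.Icc (0 : ℝ) T, ℝ)) : closeUp c 0 = closeUp c T := by
  have := hT.out.ne'
  rw [closeUp, closeUp, Set.projIcc_left, Set.projIcc_right]
  field_simp; ring

/-- A left inverse of `unrollCLM`. -/
def rollCLM : C(Set.Icc (0 : ℝ) T, ℝ) →L[ℝ] C(AddCircle T, ℝ) :=
  LinearMap.mkContinuous
    { toFun := fun c => ⟨AddCircle.liftIco T 0 (closeUp c),
        AddCircle.liftIco_zero_continuous (closeUp_zero c) (by unfold closeUp; fun_prop)⟩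
      map_add' := fun u v => by
        ext x
        obtain ⟨t, ht, rfl⟩ : ∃ t ∈ Set.Ico 0 T, (t : AddCircle T) = x := by
          obtain ⟨t, ht⟩ := (AddCircle.equivIco T 0).symm.surjective x
          exact ⟨t, by simpa using t.2, ht⟩
        simp only [ContinuousMap.coe_mk, ContinuousMap.add_apply,
          AddCircle.liftIco_zero_coe_apply ht, closeUp]
        ring
      map_smul' := fun c u => by
        ext x
        obtain ⟨t, ht, rfl⟩ : ∃ t ∈ Set.Ico 0 T, (t : AddCircle T) = x := by
          obtain ⟨t, ht⟩ := (AddCircle.equivIco T 0).symm.surjective x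
          exact ⟨t, by simpa using t.2, ht⟩
        simp only [ContinuousMap.coe_mk, ContinuousMap.smul_apply, smul_eq_mul, RingHom.id_apply,
          AddCircle.liftIco_zero_coe_apply ht, closeUp]
        ring } 3 fun c => by
      refine (ContinuousMap.norm_le _ (by positivity)).2 fun x => ?_
      obtain ⟨t, ht, rfl⟩ : ∃ t ∈ Set.Ico 0 T, (t : AddCircle T) = x := by
        obtain ⟨t, ht⟩ := (AddCircle.equivIco T 0).symm.surjective x
        exact ⟨t, by simpa using t.2, ht⟩
      change ‖AddCircle.liftIco T 0 (closeUp c) t‖ ≤ _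
      rw [AddCircle.liftIco_zero_coe_apply ht, closeUp]
      have h1 : 0 ≤ t / T := div_nonneg ht.1 hT.out.le
      have h2 : t / T ≤ 1 := (div_le_one hT.out).2 ht.2.le
      refine (norm_sub_le _ _).trans ?_
      rw [norm_mul, Real.norm_of_nonneg h1]
      have h3 := norm_sub_le (c ⟨T, hT.out.le, le_rfl⟩) (c ⟨0, le_rfl, hT.out.le⟩)
      have h4 := fun y => c.norm_coe_le_norm y
      nlinarith [h4 ⟨T, hT.out.le, le_rfl⟩, h4 ⟨0, le_rfl, hT.out.le⟩,
        h4 (Set.projIcc 0 T hT.out.le t), norm_nonneg (c ⟨T, hT.out.le, le_rfl⟩ -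
          c ⟨0, le_rfl, hT.out.le⟩)]

/-- With equal end values the affine correction in `closeUp` vanishes; it is there only to make
gluing a bounded linear map on all of `C([0, T])`. -/
theorem rollCLM_apply {c : C(Set.Icc (0 : ℝ) T, ℝ)}
    (hc : c ⟨0, le_rfl, hT.out.le⟩ = c ⟨T, hT.out.le, le_rfl⟩) {t : ℝ} (ht : t ∈ Set.Ico 0 T) :
    rollCLM c t = c ⟨t, ht.1, ht.2.le⟩ := by
  change AddCircle.liftIco T 0 (closeUp c) t = _
  rw [AddCircle.liftIco_zero_coe_apply ht, closeUp, hc, sub_self, mul_zero, sub_zero,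
    Set.projIcc_of_mem _ ⟨ht.1, ht.2.le⟩]

end Circle

end Subharmonic

end

noncomputable section

namespace Subharmonic

open Filter Topology

/-! ### Composition along curves near the resonant motion -/

section Composition

variable {T : ℝ} [hT : Fact (0 < T)]

/-- Composition with `f` along curves close to `t ↦ (ν t, A₀, t + t₀)`, as an analytic operator
between spaces of periodic functions. -/
theorem exists_composition {W : Set ℝ} (hW : IsOpen W) {f : ℝ → ℝ → ℝ → ℝ}
    (hf : AnalyticOnNhd ℝ (fun x : ℝ × ℝ × ℝ => f x.1 x.2.1 x.2.2)
      (Set.univ ×ˢ W ×ˢ Set.univ))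
    (hfα : ∀ α t, ∀ A ∈ W, f (α + 2 * Real.pi) A t = f α A t)
    (hft : ∀ α t, ∀ A ∈ W, f α A (t + 2 * Real.pi) = f α A t)
    {p : ℤ} {q : ℕ} {ν A₀ : ℝ} (hT' : T = 2 * Real.pi * q) (hν : ν * T = 2 * Real.pi * p)
    (hA₀ : A₀ ∈ W) (t₀ : ℝ) :
    ∃ 𝓕 : C(AddCircle T, ℝ) × C(AddCircle T, ℝ) → C(AddCircle T, ℝ), AnalyticAt ℝ 𝓕 0 ∧
      ∀ᶠ v in 𝓝 0, ∀ t : ℝ, 𝓕 v t = f (ν * t + v.1 t) (A₀ + v.2 t) (t + t₀) := by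
  let f₃ : ℝ × ℝ × ℝ → ℝ := fun x => f x.1 x.2.1 x.2.2
  -- The curve `(ν t, A₀, t + t₀)` does not close up in `ℝ³`, so the superposition is taken on `[0,
  -- T]` and glued afterwards.
  let z : C(Set.Icc (0 : ℝ) T, ℝ × ℝ × ℝ) := ⟨fun t => (ν * t, A₀, t + t₀), by fun_prop⟩
  let i₁ : C(AddCircle T, ℝ) →L[ℝ] C(Set.Icc (0 : ℝ) T, ℝ × ℝ × ℝ) :=
    ((ContinuousLinearMap.inl ℝ ℝ (ℝ × ℝ)).compLeftContinuous ℝ (Set.Icc (0 : ℝ) T)).comp unrollCLM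
  let i₂ : C(AddCircle T, ℝ) →L[ℝ] C(Set.Icc (0 : ℝ) T, ℝ × ℝ × ℝ) :=
    (((ContinuousLinearMap.inr ℝ ℝ (ℝ × ℝ)).comp
      (ContinuousLinearMap.inl ℝ ℝ ℝ)).compLeftContinuous ℝ (Set.Icc (0 : ℝ) T)).comp unrollCLM
  let Θ : C(AddCircle T, ℝ) × C(AddCircle T, ℝ) → C(Set.Icc (0 : ℝ) T, ℝ × ℝ × ℝ) :=
    fun v => z + i₁.coprod i₂ v
  have hΘ : AnalyticAt ℝ Θ 0 := analyticAt_const.add ((i₁.coprod i₂).analyticAt 0)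
  have hΘv : ∀ v t, Θ v t = (ν * t + v.1 (t : ℝ), A₀ + v.2 (t : ℝ), t + t₀) := by
    intro v t
    simp [Θ, z, i₁, i₂]
  have hΘ0 : Θ 0 = z := by simp [Θ]
  have hz : ∀ t, AnalyticAt ℝ f₃ (Θ 0 t) := fun t => by
    rw [hΘ0]; exact hf _ ⟨trivial, hA₀, trivial⟩
  refine ⟨fun v => rollCLM (superpose f₃ (Θ v)), ?_, ?_⟩
  · exact (rollCLM.analyticAt _).fun_comp (f := fun v => superpose f₃ (Θ v))
      ((analyticAt_superpose hz).fun_comp hΘ)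
  have hWo : IsOpen {v : C(AddCircle T, ℝ) × C(AddCircle T, ℝ) | ∀ x, v.2 x ∈ (A₀ + ·) ⁻¹' W} :=
    (isOpen_setOf_forall_mem (hW.preimage (continuous_const_add A₀))).preimage continuous_snd
  filter_upwards [hΘ.continuousAt.eventually (eventually_superpose_apply hz),
    hWo.mem_nhds (by simpa using hA₀)] with v hv hvW t
  -- Over time `T` the angle advances by `2πp` and time by `2πq`, both invisible to `f`.
  have hper : ∀ t : ℝ, f (ν * (t + T) + v.1 ((t + T : ℝ) : AddCircle T))
      (A₀ + v.2 ((t + T : ℝ) : AddCircle T)) (t + T + t₀) =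
      f (ν * t + v.1 t) (A₀ + v.2 t) (t + t₀) := by
    intro t
    have hmem : A₀ + v.2 t ∈ W := hvW t
    have h1 : Function.Periodic (fun α => f α (A₀ + v.2 t) (t + t₀)) (2 * Real.pi) :=
      fun α => hfα α _ _ hmem
    have h2 : Function.Periodic (fun s => f (ν * t + v.1 t + p * (2 * Real.pi)) (A₀ + v.2 t) s)
        (2 * Real.pi) := fun s => hft _ _ _ hmem
    rw [AddCircle.coe_add_period]
    have h3 := h1.int_mul p (ν * t + v.1 t)
    have h4 := h2.nat_mul q (t + t₀)
    rw [← h3, ← h4]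
    congr 1
    · rw [mul_add, hν]; ring
    · rw [hT']; ring
  have hDp : Function.Periodic (fun t : ℝ => rollCLM (superpose f₃ (Θ v)) t -
      f (ν * t + v.1 t) (A₀ + v.2 t) (t + t₀)) T := fun t => by
    simp only [hper t]; rw [AddCircle.coe_add_period]
  obtain ⟨y, hy, hyt⟩ := hDp.exists_mem_Ico₀ hT.out t
  rw [← sub_eq_zero, hyt, rollCLM_apply _ hy, (hv _).2, hΘv, sub_self]
  rw [(hv _).2, (hv _).2, hΘv, hΘv]
  have := hper 0
  simp only [zero_add] at this
  simpa only [f₃, zero_add] using this.symm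

/-- Composition with the part of `ω` which is nonlinear at `A₀`, as an analytic operator. -/
theorem exists_composition_remainder {ω : ℝ → ℝ} {A₀ : ℝ} (hω : AnalyticAt ℝ ω A₀) :
    ∃ 𝓦 : C(AddCircle T, ℝ) → C(AddCircle T, ℝ), AnalyticAt ℝ 𝓦 0 ∧ 𝓦 0 = 0 ∧
      HasFDerivAt 𝓦 (0 : C(AddCircle T, ℝ) →L[ℝ] C(AddCircle T, ℝ)) 0 ∧
      ∀ᶠ v in 𝓝 0, ∀ t : ℝ, 𝓦 v t = ω (A₀ + v t) - ω A₀ - deriv ω A₀ * v t := by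
  let w : ℝ → ℝ := fun y => ω (A₀ + y) - ω A₀ - deriv ω A₀ * y
  have hw : AnalyticAt ℝ w 0 := by
    have : AnalyticAt ℝ (fun y => ω (A₀ + y)) 0 :=
      hω.comp_of_eq (f := fun y => A₀ + y) (by fun_prop) (by simp)
    exact (this.fun_sub analyticAt_const).fun_sub (by fun_prop)
  have hwd : HasDerivAt w 0 0 := by
    have h1 : HasDerivAt (fun y => ω (A₀ + y)) (deriv ω A₀) 0 := by
      have := hω.differentiableAt.hasDerivAt
      rw [← add_zero A₀] at this
      simpa using HasDerivAt.comp_const_add A₀ 0 this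
    have h2 := (h1.sub_const (ω A₀)).fun_sub ((hasDerivAt_id (0 : ℝ)).const_mul (deriv ω A₀))
    simpa using h2
  have h0 : ∀ x : AddCircle T, AnalyticAt ℝ w ((0 : C(AddCircle T, ℝ)) x) := fun x => by simpa
  have hev := eventually_superpose_apply h0
  have han := analyticAt_superpose h0
  refine ⟨superpose w, han, ?_, ?_, ?_⟩
  · ext x
    rw [(hev.self_of_nhds x).2]; simp [w]
  · have hd := han.differentiableAt.hasFDerivAt
    -- The derivative is already known to exist, so its vanishing can be checked after evaluation at
    -- each point, where it reduces to `w' 0 = 0`.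
    suffices fderiv ℝ (superpose w : C(AddCircle T, ℝ) → C(AddCircle T, ℝ)) 0 = 0 by rwa [this] at hd
    ext v x
    have h1 : HasFDerivAt (fun u => superpose w u x) ((ContinuousMap.evalCLM ℝ x).comp
        (fderiv ℝ (superpose w : C(AddCircle T, ℝ) → C(AddCircle T, ℝ)) 0)) 0 :=
      HasFDerivAt.comp (g := fun y : C(AddCircle T, ℝ) => y x) 0
        ((ContinuousMap.evalCLM ℝ x).hasFDerivAt (x := superpose w 0)) hd
    have h2 : HasFDerivAt (fun u : C(AddCircle T, ℝ) => w (u x))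
        ((0 : ℝ) • (ContinuousMap.evalCLM ℝ x : C(AddCircle T, ℝ) →L[ℝ] ℝ)) 0 :=
      HasDerivAt.comp_hasFDerivAt (h₂ := w) (f := fun u : C(AddCircle T, ℝ) => u x) 0
        (by simpa using hwd) ((ContinuousMap.evalCLM ℝ x).hasFDerivAt (x := (0 : C(AddCircle T, ℝ))))
    have h3 := h1.unique (h2.congr_of_eventuallyEq (hev.mono fun u hu => (hu x).2))
    have h4 := DFunLike.congr_fun h3 v
    simpa using h4
  · exact hev.mono fun v hv t => (hv t).2

end Composition

end Subharmonic

end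

noncomputable section

namespace Subharmonic

open Filter Topology

/-! ### Solution of the range equations -/

section Reduction

variable {T : ℝ} [hT : Fact (0 < T)]

/-- Lyapunov–Schmidt reduction: for every small `ε = e.2` and every small constant `b = e.1` added
to the angle there are periodic `β e`, `B e`, analytic in `e`, which solve the range equations. -/
theorem exists_reduction {W : Set ℝ} (hW : IsOpen W) {ω : ℝ → ℝ} {F G : ℝ → ℝ → ℝ → ℝ}
    (hω : AnalyticOnNhd ℝ ω W)
    (hF : AnalyticOnNhd ℝ (fun x : ℝ × ℝ × ℝ => F x.1 x.2.1 x.2.2)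
      (Set.univ ×ˢ W ×ˢ Set.univ))
    (hG : AnalyticOnNhd ℝ (fun x : ℝ × ℝ × ℝ => G x.1 x.2.1 x.2.2)
      (Set.univ ×ˢ W ×ˢ Set.univ))
    (hFα : ∀ α t, ∀ A ∈ W, F (α + 2 * Real.pi) A t = F α A t)
    (hFt : ∀ α t, ∀ A ∈ W, F α A (t + 2 * Real.pi) = F α A t)
    (hGα : ∀ α t, ∀ A ∈ W, G (α + 2 * Real.pi) A t = G α A t)
    (hGt : ∀ α t, ∀ A ∈ W, G α A (t + 2 * Real.pi) = G α A t)
    {p : ℤ} {q : ℕ} {ν A₀ : ℝ} (hT' : T = 2 * Real.pi * q) (hν : ν * T = 2 * Real.pi * p)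
    (hA₀ : A₀ ∈ W) (t₀ : ℝ) :
    ∃ β B Φ D : ℝ × ℝ → C(AddCircle T, ℝ),
      AnalyticAt ℝ β 0 ∧ AnalyticAt ℝ B 0 ∧ AnalyticAt ℝ Φ 0 ∧ AnalyticAt ℝ D 0 ∧
      (∀ᶠ b in 𝓝 (0 : ℝ), β (b, 0) = 0 ∧ B (b, 0) = 0) ∧
      ∀ᶠ e in 𝓝 (0 : ℝ × ℝ),
        β e = primitiveCLM (Φ e) + deriv ω A₀ • primitiveCLM (primitiveCLM (e.2 • D e)) ∧
        B e = primitiveCLM (e.2 • D e) - (meanCLM (Φ e) / deriv ω A₀) • 1 ∧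
        (∀ t : ℝ, A₀ + B e t ∈ W) ∧
        (∀ t : ℝ, Φ e t = e.2 * F (ν * t + (e.1 + β e t)) (A₀ + B e t) (t + t₀) +
          (ω (A₀ + B e t) - ω A₀ - deriv ω A₀ * B e t)) ∧
        ∀ t : ℝ, D e t = G (ν * t + (e.1 + β e t)) (A₀ + B e t) (t + t₀) := by
  obtain ⟨𝓕, h𝓕, h𝓕e⟩ := exists_composition hW hF hFα hFt hT' hν hA₀ t₀
  obtain ⟨𝓖, h𝓖, h𝓖e⟩ := exists_composition hW hG hGα hGt hT' hν hA₀ t₀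
  obtain ⟨𝓦, h𝓦, h𝓦0, h𝓦d, h𝓦e⟩ := exists_composition_remainder (T := T) (hω A₀ hA₀)
  let κ : (ℝ × ℝ) × (C(AddCircle T, ℝ) × C(AddCircle T, ℝ)) →
    C(AddCircle T, ℝ) × C(AddCircle T, ℝ) := fun x => (x.1.1 • (1 : C(AddCircle T, ℝ)) + x.2.1, x.2.2)
  have hκ0 : κ 0 = 0 := by simp [κ]
  have hκ : AnalyticAt ℝ κ 0 := by
    refine AnalyticAt.prod (AnalyticAt.fun_add (AnalyticAt.fun_smul ?_ analyticAt_const) ?_) ?_ <;>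
    fun_prop
  let Φ' : (ℝ × ℝ) × (C(AddCircle T, ℝ) × C(AddCircle T, ℝ)) →
    C(AddCircle T, ℝ) := fun x => x.1.2 • 𝓕 (κ x) + 𝓦 x.2.2
  let D' : (ℝ × ℝ) × (C(AddCircle T, ℝ) × C(AddCircle T, ℝ)) →
    C(AddCircle T, ℝ) := fun x => 𝓖 (κ x)
  have hD' : AnalyticAt ℝ D' 0 := h𝓖.comp_of_eq hκ hκ0
  have hΦ' : AnalyticAt ℝ Φ' 0 := by
    refine AnalyticAt.fun_add (AnalyticAt.fun_smul ?_ (h𝓕.comp_of_eq hκ hκ0))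
      (h𝓦.comp_of_eq (f := fun x : (ℝ × ℝ) × (C(AddCircle T, ℝ) × C(AddCircle T, ℝ)) => x.2.2) ?_ rfl) <;>
    fun_prop
  have hΓ' : AnalyticAt ℝ (fun x => x.1.2 • D' x) 0 := AnalyticAt.fun_smul (by fun_prop) hD'
  let S : (ℝ × ℝ) × (C(AddCircle T, ℝ) × C(AddCircle T, ℝ)) →
    C(AddCircle T, ℝ) × C(AddCircle T, ℝ) := fun x =>
    (primitiveCLM (Φ' x) + deriv ω A₀ • primitiveCLM (primitiveCLM (x.1.2 • D' x)),
      primitiveCLM (x.1.2 • D' x) - (meanCLM (Φ' x) / deriv ω A₀) • (1 : C(AddCircle T, ℝ)))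
  have hP : ∀ {f : (ℝ × ℝ) × (C(AddCircle T, ℝ) × C(AddCircle T, ℝ)) →
    C(AddCircle T, ℝ)}, AnalyticAt ℝ f 0 →
      AnalyticAt ℝ (fun x => primitiveCLM (f x)) 0 := fun hf =>
    (primitiveCLM.analyticAt _).fun_comp hf
  have hS : AnalyticAt ℝ S 0 := by
    refine AnalyticAt.prod ((hP hΦ').fun_add (analyticAt_const.fun_smul (hP (hP hΓ'))))
      ((hP hΓ').fun_sub (AnalyticAt.fun_smul ?_ analyticAt_const))
    simp only [div_eq_mul_inv]
    exact ((meanCLM.analyticAt _).fun_comp hΦ').fun_mul analyticAt_const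
  let Ψ : (ℝ × ℝ) × (C(AddCircle T, ℝ) × C(AddCircle T, ℝ)) →
    C(AddCircle T, ℝ) × C(AddCircle T, ℝ) := fun x => x.2 - S x
  have hΨ : AnalyticAt ℝ Ψ 0 := analyticAt_snd.fun_sub hS
  have hS0 : ∀ b : ℝ, S ((b, 0), 0) = 0 := by
    intro b; simp [S, Φ', h𝓦0, -meanCLM_apply]
  have hΨ0 : ∀ b : ℝ, Ψ ((b, 0), 0) = 0 := by
    intro b; simp [Ψ, hS0]
  -- At `b = ε = 0` the map is `u - L (𝓦 u.2)` with `𝓦` having zero derivative at the origin, so the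
  -- linearization is the identity.
  have hinv : (fderiv ℝ Ψ 0 ∘L .inr ℝ (ℝ × ℝ) (C(AddCircle T, ℝ) × C(AddCircle T, ℝ))).IsInvertible := by
    have h1 : HasFDerivAt (fun u : C(AddCircle T, ℝ) × C(AddCircle T, ℝ) => Ψ (0, u))
        (fderiv ℝ Ψ 0 ∘L .inr ℝ (ℝ × ℝ) (C(AddCircle T, ℝ) × C(AddCircle T, ℝ))) 0 :=
      HasFDerivAt.comp (g := Ψ) (f := fun u => ((0 : ℝ × ℝ), u)) 0
        hΨ.differentiableAt.hasFDerivAt (ContinuousLinearMap.inr ℝ (ℝ × ℝ) (C(AddCircle T, ℝ) × C(AddCircle T, ℝ))).hasFDerivAt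
    let L : C(AddCircle T, ℝ) →L[ℝ] C(AddCircle T, ℝ) × C(AddCircle T, ℝ) :=
      primitiveCLM.prod (-((deriv ω A₀)⁻¹ • meanCLM.smulRight (1 : C(AddCircle T, ℝ))))
    have h2 : ∀ u : C(AddCircle T, ℝ) × C(AddCircle T, ℝ), Ψ (0, u) = u - L (𝓦 u.2) := by
      intro u
      simp [Ψ, S, Φ', L, div_eq_inv_mul, smul_smul, -meanCLM_apply]
    have h3 : HasFDerivAt (fun u : C(AddCircle T, ℝ) × C(AddCircle T, ℝ) => Ψ (0, u)) (ContinuousLinearMap.id ℝ (C(AddCircle T, ℝ) × C(AddCircle T, ℝ))) 0 := by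
      have h4 : HasFDerivAt (fun u : C(AddCircle T, ℝ) × C(AddCircle T, ℝ) => 𝓦 u.2)
          ((0 : C(AddCircle T, ℝ) →L[ℝ] C(AddCircle T, ℝ)) ∘L .snd ℝ C(AddCircle T, ℝ) C(AddCircle T, ℝ)) 0 :=
        HasFDerivAt.comp (g := 𝓦) (f := fun u : C(AddCircle T, ℝ) × C(AddCircle T, ℝ) => u.2) 0 h𝓦d hasFDerivAt_snd
      have h5 : HasFDerivAt (fun u : C(AddCircle T, ℝ) × C(AddCircle T, ℝ) => L (𝓦 u.2))
          (L ∘L ((0 : C(AddCircle T, ℝ) →L[ℝ] C(AddCircle T, ℝ)) ∘L .snd ℝ C(AddCircle T, ℝ) C(AddCircle T, ℝ))) 0 :=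
        HasFDerivAt.comp (g := L) 0 L.hasFDerivAt h4
      have h6 := (hasFDerivAt_id (𝕜 := ℝ) (0 : C(AddCircle T, ℝ) × C(AddCircle T, ℝ))).fun_sub h5
      simp only [ContinuousLinearMap.zero_comp, ContinuousLinearMap.comp_zero, sub_zero] at h6
      exact h6.congr_of_eventuallyEq (Eventually.of_forall h2)
    rw [h1.unique h3]
    exact ⟨ContinuousLinearEquiv.refl ℝ _, rfl⟩
  obtain ⟨ψ, hψ, hψ0, hψe, hψu⟩ := exists_analytic_implicit hΨ hinv
  simp only [Prod.fst_zero, Prod.snd_zero] at hψ hψ0 hψe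
  have hΨ00 : Ψ 0 = 0 := hΨ0 0
  have hx : AnalyticAt ℝ (fun e => (e, ψ e)) 0 := analyticAt_id.prod hψ
  have hx0 : ((0 : ℝ × ℝ), ψ 0) = 0 := by rw [hψ0]; rfl
  refine ⟨fun e => (ψ e).1, fun e => (ψ e).2, fun e => Φ' (e, ψ e), fun e => D' (e, ψ e),
    analyticAt_fst.fun_comp hψ, analyticAt_snd.fun_comp hψ, hΦ'.comp_of_eq hx hx0,
    hD'.comp_of_eq hx hx0, ?_, ?_⟩
  -- At `ε = 0` the zero function solves the equations for every `b`; local uniqueness identifies it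
  -- with the implicit solution.
  · have hc : Tendsto (fun b : ℝ => (((b, (0 : ℝ)), (0 : C(AddCircle T, ℝ) × C(AddCircle T, ℝ))) : (ℝ × ℝ) × (C(AddCircle T, ℝ) × C(AddCircle T, ℝ))))
        (𝓝 0) (𝓝 0) := Continuous.tendsto' (by fun_prop) _ _ rfl
    filter_upwards [hc.eventually hψu] with b hb
    have h1 := hb.1 (by rw [hΨ0, hΨ00])
    rw [h1]; simp
  · have hκx : Tendsto (fun e => κ (e, ψ e)) (𝓝 0) (𝓝 0) := by
      have := (hκ.comp_of_eq hx hx0).continuousAt.tendsto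
      simpa only [Function.comp_def, hx0, hκ0] using this
    have hψ2 : Tendsto (fun e => (ψ e).2) (𝓝 0) (𝓝 0) := by
      have := hψ.continuousAt.snd.tendsto
      simpa only [hψ0, Prod.snd_zero] using this
    have hWo : IsOpen {v : C(AddCircle T, ℝ) | ∀ x, v x ∈ (A₀ + ·) ⁻¹' W} :=
      isOpen_setOf_forall_mem (hW.preimage (continuous_const_add A₀))
    filter_upwards [hψe, hκx.eventually h𝓕e, hκx.eventually h𝓖e, hψ2.eventually h𝓦e,
      hψ2.eventually (hWo.mem_nhds (by simpa using hA₀))] with e h1 h2 h3 h4 h5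
    have h6 : ψ e = S (e, ψ e) := by
      rw [hΨ00] at h1; exact sub_eq_zero.1 h1
    refine ⟨congrArg Prod.fst h6, congrArg Prod.snd h6, fun t => h5 t, fun t => ?_, fun t => ?_⟩
    · simp only [Φ', ContinuousMap.add_apply, ContinuousMap.smul_apply, h2, h4, smul_eq_mul]
      simp [κ]
    · simp only [D', h3]
      simp [κ]

end Reduction

end Subharmonic

end

noncomputable section

namespace Subharmonic

open Filter Topology Asymptotics

/-! ### Taylor coefficients of Banach-space-valued functions -/

section VectorTaylor

variable {V : Type*} [NormedAddCommGroup V] [NormedSpace ℝ V]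

/-- The `k`-th Taylor coefficient at `0` of a vector-valued function. -/
def vectorCoeff (k : ℕ) (f : ℝ → V) : V := (k.factorial : ℝ)⁻¹ • iteratedDeriv k f 0

theorem vectorCoeff_zero (f : ℝ → V) : vectorCoeff 0 f = f 0 := by simp [vectorCoeff]

theorem vectorCoeff_eq_taylorCoeff (k : ℕ) (f : ℝ → ℝ) : vectorCoeff k f = taylorCoeff k f := by
  rw [vectorCoeff, taylorCoeff, smul_eq_mul, div_eq_inv_mul]

theorem vectorCoeff_congr {f g : ℝ → V} (h : f =ᶠ[𝓝 0] g) (k : ℕ) :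
    vectorCoeff k f = vectorCoeff k g := by
  rw [vectorCoeff, vectorCoeff, h.iteratedDeriv_eq]

variable [CompleteSpace V]

theorem vectorCoeff_add {f g : ℝ → V} (hf : AnalyticAt ℝ f 0) (hg : AnalyticAt ℝ g 0) (k : ℕ) :
    vectorCoeff k (fun x => f x + g x) = vectorCoeff k f + vectorCoeff k g := by
  rw [vectorCoeff, vectorCoeff, vectorCoeff, iteratedDeriv_fun_add hf.contDiffAt hg.contDiffAt,
    smul_add]

theorem vectorCoeff_clm {V' : Type*} [NormedAddCommGroup V'] [NormedSpace ℝ V'] (L : V →L[ℝ] V')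
    {f : ℝ → V} (hf : AnalyticAt ℝ f 0) (k : ℕ) :
    vectorCoeff k (fun x => L (f x)) = L (vectorCoeff k f) := by
  have h := L.iteratedFDeriv_comp_left (hf.contDiffAt (n := k)) le_rfl
  rw [vectorCoeff, vectorCoeff, map_smul, iteratedDeriv_eq_iteratedFDeriv,
    iteratedDeriv_eq_iteratedFDeriv]
  congr 1
  have := congrArg (fun m => m fun _ => (1 : ℝ)) h
  exact this

theorem isBigO_sub_taylor {f : ℝ → V} (hf : AnalyticAt ℝ f 0) (n : ℕ) :
    (fun x => (∑ j ∈ Finset.range n, x ^ j • vectorCoeff j f) - f x) =O[𝓝 0] fun x => x ^ n := by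
  obtain ⟨g, hg, hE⟩ := hf.exists_eventuallyEq_sum_add_pow_mul n
  have h1 : (fun x : ℝ => -(x ^ n • g x)) =O[𝓝 0] fun x => x ^ n := by
    have h2 : g =O[𝓝 0] fun _ => (1 : ℝ) := hg.continuousAt.isBigO_one ℝ
    simpa using ((isBigO_refl (fun x : ℝ => x ^ n) (𝓝 0)).smul h2).neg_left
  refine h1.congr' ?_ EventuallyEq.rfl
  filter_upwards [hE] with x hx
  rw [hx]
  have : ∀ j, x ^ j • vectorCoeff j f = (x ^ j / j.factorial) • iteratedDeriv j f 0 := fun j => by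
    rw [vectorCoeff, smul_smul, div_eq_mul_inv]
  simp only [this]
  abel

end VectorTaylor

/-! ### The formal recursion and the Taylor coefficients of the analytic solution -/

section Recursion

/-- Because `Θ (0, ·)` has zero derivative at `z`, strict differentiability makes the two
compositions differ by `o(x - y)`, hence by `o(ε ^ m)`. This is why order `k + 1` of `Φ` and `Γ`
involves only the terms of order at most `k`. -/
theorem taylorCoeff_eq_of_curves {Θ : ℝ × (ℝ × ℝ) → ℝ} {z : ℝ × ℝ} (hΘ : AnalyticAt ℝ Θ (0, z))
    (hd : HasFDerivAt (fun w => Θ (0, w)) (0 : ℝ × ℝ →L[ℝ] ℝ) z) {x y : ℝ → ℝ × ℝ}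
    (hx : AnalyticAt ℝ x 0) (hy : AnalyticAt ℝ y 0) (hx0 : x 0 = z) (hy0 : y 0 = z) {m : ℕ}
    (hxy : (fun ε => x ε - y ε) =O[𝓝 0] fun ε => ε ^ m) :
    taylorCoeff m (fun ε => Θ (ε, x ε)) = taylorCoeff m (fun ε => Θ (ε, y ε)) := by
  have hX : AnalyticAt ℝ (fun ε => (ε, x ε)) 0 := analyticAt_id.prod hx
  have hY : AnalyticAt ℝ (fun ε => (ε, y ε)) 0 := analyticAt_id.prod hy
  refine taylorCoeff_eq_of_isLittleO (hΘ.comp_of_eq hX (by rw [hx0]))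
    (hΘ.comp_of_eq hY (by rw [hy0])) ?_ le_rfl
  have hL : ∀ w, fderiv ℝ Θ (0, z) (0, w) = 0 := by
    have h1 : HasFDerivAt (fun w => Θ (0, w)) (fderiv ℝ Θ (0, z) ∘L .inr ℝ ℝ (ℝ × ℝ)) z :=
      HasFDerivAt.comp (g := Θ) (f := fun w => ((0 : ℝ), w)) z
        hΘ.differentiableAt.hasFDerivAt (ContinuousLinearMap.inr ℝ ℝ (ℝ × ℝ)).hasFDerivAt
    intro w
    exact DFunLike.congr_fun (h1.unique hd) w
  have hs := hΘ.hasStrictFDerivAt.isLittleO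
  have ht : Tendsto (fun ε => ((ε, x ε), (ε, y ε))) (𝓝 0) (𝓝 (((0 : ℝ), z), ((0 : ℝ), z))) := by
    have := hX.continuousAt.tendsto.prodMk_nhds hY.continuousAt.tendsto
    simpa only [hx0, hy0] using this
  have h2 := hs.comp_tendsto ht
  have h3 : (fun ε => Θ (ε, x ε) - Θ (ε, y ε)) =o[𝓝 0] fun ε => x ε - y ε := by
    refine (h2.congr_left (f₂ := fun ε => Θ (ε, x ε) - Θ (ε, y ε)) fun ε => ?_).trans_isBigO ?_
    · have h3 : (ε, x ε) - (ε, y ε) = ((0 : ℝ), x ε - y ε) := by simp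
      simp only [Function.comp_def, h3, hL, sub_zero]
    · refine IsBigO.of_bound 1 (Eventually.of_forall fun ε => ?_)
      simp [Prod.norm_def]
  exact h3.trans_isBigO hxy

variable {T : ℝ} [hT : Fact (0 < T)]

/-- The partial sums of order `k` of the curve `ε ↦ (ν t + β ε (t - s), A₀ + B ε (t - s))`. -/
def truncatedCurve (ν A₀ s : ℝ) (β B : ℝ → C(AddCircle T, ℝ)) (k : ℕ) (ε t : ℝ) : ℝ × ℝ :=
  (ν * t + ∑ j ∈ Finset.range (k + 1), ε ^ j * vectorCoeff j β (t - s : ℝ),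
    A₀ + ∑ j ∈ Finset.range (k + 1), ε ^ j * vectorCoeff j B (t - s : ℝ))

theorem analyticAt_circle_apply {f : ℝ → C(AddCircle T, ℝ)} (hf : AnalyticAt ℝ f 0)
    (x : AddCircle T) : AnalyticAt ℝ (fun ε => f ε x) 0 :=
  ((ContinuousMap.evalCLM ℝ x).analyticAt (f 0)).fun_comp hf

theorem vectorCoeff_circle_apply {f : ℝ → C(AddCircle T, ℝ)} (hf : AnalyticAt ℝ f 0)
    (x : AddCircle T) (k : ℕ) : vectorCoeff k f x = taylorCoeff k fun ε => f ε x := by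
  rw [← vectorCoeff_eq_taylorCoeff]
  exact (vectorCoeff_clm (ContinuousMap.evalCLM ℝ x) hf k).symm

theorem isBigO_sum_sub_circle {f : ℝ → C(AddCircle T, ℝ)} (hf : AnalyticAt ℝ f 0)
    (x : AddCircle T) (n : ℕ) :
    (fun ε => (∑ j ∈ Finset.range n, ε ^ j * vectorCoeff j f x) - f ε x) =O[𝓝 0]
      fun ε => ε ^ n := by
  have h1 := ((ContinuousMap.evalCLM ℝ x : C(AddCircle T, ℝ) →L[ℝ] ℝ).isBigO_comp _ _).trans
    (isBigO_sub_taylor hf n)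
  refine h1.congr_left fun ε => ?_
  simp

theorem taylorCoeff_truncatedCurve {β B : ℝ → C(AddCircle T, ℝ)} (hβ : AnalyticAt ℝ β 0)
    (hB : AnalyticAt ℝ B 0) (hβ0 : β 0 = 0) (hB0 : B 0 = 0) {ν A₀ s t : ℝ}
    {Θ : ℝ × (ℝ × ℝ) → ℝ} (hΘ : AnalyticAt ℝ Θ (0, (ν * t, A₀)))
    (hd : HasFDerivAt (fun w => Θ (0, w)) (0 : ℝ × ℝ →L[ℝ] ℝ) (ν * t, A₀)) (k : ℕ) :
    taylorCoeff (k + 1) (fun ε => Θ (ε, truncatedCurve ν A₀ s β B k ε t)) =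
      taylorCoeff (k + 1) (fun ε => Θ (ε, (ν * t + β ε (t - s : ℝ), A₀ + B ε (t - s : ℝ)))) := by
  refine taylorCoeff_eq_of_curves hΘ hd ?_ ?_ ?_ ?_ ?_
  · unfold truncatedCurve
    exact AnalyticAt.prod (by fun_prop) (by fun_prop)
  · exact (analyticAt_const.fun_add (analyticAt_circle_apply hβ _)).prod
      (analyticAt_const.fun_add (analyticAt_circle_apply hB _))
  · simp only [truncatedCurve, Finset.sum_range_succ']
    simp [vectorCoeff_zero, hβ0, hB0]
  · simp [hβ0, hB0]
  · refine ((isBigO_sum_sub_circle hβ ((t - s : ℝ) : AddCircle T) (k + 1)).prod_left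
      (isBigO_sum_sub_circle hB ((t - s : ℝ) : AddCircle T) (k + 1))).congr_left fun ε => ?_
    simp [truncatedCurve]

theorem analyticAt_eps_mul {W : Set ℝ} {F : ℝ → ℝ → ℝ → ℝ}
    (hF : AnalyticOnNhd ℝ (fun x : ℝ × ℝ × ℝ => F x.1 x.2.1 x.2.2)
      (Set.univ ×ˢ W ×ˢ Set.univ)) {A₀ : ℝ} (hA₀ : A₀ ∈ W) (a τ : ℝ) :
    AnalyticAt ℝ (fun x : ℝ × (ℝ × ℝ) => x.1 * F x.2.1 x.2.2 τ) (0, (a, A₀)) := by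
  refine analyticAt_fst.fun_mul ?_
  exact (hF (a, A₀, τ) ⟨trivial, hA₀, trivial⟩).comp_of_eq
    (f := fun x : ℝ × (ℝ × ℝ) => (x.2.1, x.2.2, τ)) (by fun_prop) rfl

variable {W : Set ℝ} {ω : ℝ → ℝ} {F G : ℝ → ℝ → ℝ → ℝ} {A₀ b s t₀ : ℝ}
  {β B Φ D : ℝ → C(AddCircle T, ℝ)}

/-- With `b = ν s` one has `ν t + β(t - s) = ν(t - s) + b + β(t - s)` and `t + (t₀ - s) = (t - s) +
t₀`: the curve of phase `t₀ - s` without constant is the time translate by `s` of the curve of phase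
`t₀` with constant `b`. -/
theorem gammaCoeff_truncatedCurve
    (hG : AnalyticOnNhd ℝ (fun x : ℝ × ℝ × ℝ => G x.1 x.2.1 x.2.2)
      (Set.univ ×ˢ W ×ˢ Set.univ)) (hA₀ : A₀ ∈ W)
    (hβ : AnalyticAt ℝ β 0) (hB : AnalyticAt ℝ B 0) (hD : AnalyticAt ℝ D 0)
    (hβ0 : β 0 = 0) (hB0 : B 0 = 0) {ν : ℝ} (hs : ν * s = b)
    (he : ∀ᶠ ε in 𝓝 0, ∀ t : ℝ, D ε t = G (ν * t + (b + β ε t)) (A₀ + B ε t) (t + t₀))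
    (k : ℕ) (t : ℝ) :
    gammaCoeff G (t₀ - s) (k + 1) (truncatedCurve ν A₀ s β B k) t =
      vectorCoeff (k + 1) (fun ε => ε • D ε) (t - s : ℝ) := by
  have hΘ := analyticAt_eps_mul hG hA₀ (ν * t) (t + (t₀ - s))
  have h1 := taylorCoeff_truncatedCurve (s := s) hβ hB hβ0 hB0 hΘ (by
    simpa using hasFDerivAt_const (0 : ℝ) (ν * t, A₀)) k
  have hΓ : AnalyticAt ℝ (fun ε => ε • D ε) 0 := analyticAt_id.fun_smul hD
  rw [gammaCoeff, h1, vectorCoeff_circle_apply hΓ]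
  refine taylorCoeff_congr ?_ _
  filter_upwards [he] with ε hε
  simp only [ContinuousMap.smul_apply, hε, smul_eq_mul]
  congr 2 <;> linarith

theorem phiCoeff_truncatedCurve (hω : AnalyticAt ℝ ω A₀)
    (hF : AnalyticOnNhd ℝ (fun x : ℝ × ℝ × ℝ => F x.1 x.2.1 x.2.2)
      (Set.univ ×ˢ W ×ˢ Set.univ)) (hA₀ : A₀ ∈ W)
    (hβ : AnalyticAt ℝ β 0) (hB : AnalyticAt ℝ B 0) (hΦ : AnalyticAt ℝ Φ 0)
    (hβ0 : β 0 = 0) (hB0 : B 0 = 0) {ν : ℝ} (hs : ν * s = b)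
    (he : ∀ᶠ ε in 𝓝 0, ∀ t : ℝ, Φ ε t = ε * F (ν * t + (b + β ε t)) (A₀ + B ε t) (t + t₀) +
      (ω (A₀ + B ε t) - ω A₀ - deriv ω A₀ * B ε t))
    (k : ℕ) (t : ℝ) :
    phiCoeff ω F A₀ (t₀ - s) (k + 1) (truncatedCurve ν A₀ s β B k) t =
      vectorCoeff (k + 1) Φ (t - s : ℝ) := by
  have hω' : AnalyticAt ℝ (fun x : ℝ × (ℝ × ℝ) => ω x.2.2) (0, (ν * t, A₀)) :=
    hω.comp_of_eq (f := fun x : ℝ × (ℝ × ℝ) => x.2.2) (by fun_prop) rfl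
  have hΘ : AnalyticAt ℝ (fun x : ℝ × (ℝ × ℝ) => x.1 * F x.2.1 x.2.2 (t + (t₀ - s)) + ω x.2.2 -
      ω A₀ - deriv ω A₀ * (x.2.2 - A₀)) (0, (ν * t, A₀)) :=
    (((analyticAt_eps_mul hF hA₀ (ν * t) (t + (t₀ - s))).fun_add hω').fun_sub
      analyticAt_const).fun_sub (by fun_prop)
  have h1 := taylorCoeff_truncatedCurve (s := s) hβ hB hβ0 hB0 hΘ (by
    have h2 : HasDerivAt (fun y => ω y - ω A₀ - deriv ω A₀ * (y - A₀)) 0 A₀ := by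
      have := (hω.differentiableAt.hasDerivAt.sub_const (ω A₀)).fun_sub
        (((hasDerivAt_id A₀).sub_const A₀).const_mul (deriv ω A₀))
      simpa using this
    have h3 := HasDerivAt.comp_hasFDerivAt (f := Prod.snd) ((ν * t, A₀) : ℝ × ℝ) h2
      (hasFDerivAt_snd (𝕜 := ℝ))
    simpa [Function.comp_def] using h3) k
  rw [phiCoeff, h1, vectorCoeff_circle_apply hΦ]
  refine taylorCoeff_congr ?_ _
  filter_upwards [he] with ε hε
  rw [hε, show ν * t + β ε (t - s : ℝ) = ν * (t - s) + (b + β ε (t - s : ℝ)) by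
      rw [← hs]; ring, show t + (t₀ - s) = t - s + t₀ by ring]
  ring

/-- The formal solution with phase `t₀ - s` is given by the Taylor polynomials of the analytic
solution of the range equations with phase `t₀`, translated in time by `s`. -/
theorem approx_eq_truncatedCurve (hω : AnalyticAt ℝ ω A₀)
    (hF : AnalyticOnNhd ℝ (fun x : ℝ × ℝ × ℝ => F x.1 x.2.1 x.2.2)
      (Set.univ ×ˢ W ×ˢ Set.univ))
    (hG : AnalyticOnNhd ℝ (fun x : ℝ × ℝ × ℝ => G x.1 x.2.1 x.2.2)
      (Set.univ ×ˢ W ×ˢ Set.univ)) (hA₀ : A₀ ∈ W)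
    (hβ : AnalyticAt ℝ β 0) (hB : AnalyticAt ℝ B 0) (hΦ : AnalyticAt ℝ Φ 0) (hD : AnalyticAt ℝ D 0)
    (hβ0 : β 0 = 0) (hB0 : B 0 = 0) (hs : ω A₀ * s = b)
    (heβ : ∀ᶠ ε in 𝓝 0,
      β ε = primitiveCLM (Φ ε) + deriv ω A₀ • primitiveCLM (primitiveCLM (ε • D ε)))
    (heB : ∀ᶠ ε in 𝓝 0, B ε = primitiveCLM (ε • D ε) - (meanCLM (Φ ε) / deriv ω A₀) • 1)
    (heΦ : ∀ᶠ ε in 𝓝 0, ∀ t : ℝ, Φ ε t = ε * F (ω A₀ * t + (b + β ε t)) (A₀ + B ε t) (t + t₀) +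
      (ω (A₀ + B ε t) - ω A₀ - deriv ω A₀ * B ε t))
    (heD : ∀ᶠ ε in 𝓝 0, ∀ t : ℝ, D ε t = G (ω A₀ * t + (b + β ε t)) (A₀ + B ε t) (t + t₀))
    (k : ℕ) : approx ω F G A₀ T (t₀ - s) k = truncatedCurve (ω A₀) A₀ s β B k := by
  have hΓ : AnalyticAt ℝ (fun ε => ε • D ε) 0 := analyticAt_id.fun_smul hD
  -- The range equations are linear in `Φ` and `Γ`, and bounded linear operators commute with taking
  -- Taylor coefficients; so the coefficients obey the same relations order by order.
  have hcβ : ∀ j, vectorCoeff j β = primitiveCLM (vectorCoeff j Φ) +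
      deriv ω A₀ • primitiveCLM (primitiveCLM (vectorCoeff j fun ε => ε • D ε)) := by
    intro j
    let L : C(AddCircle T, ℝ) →L[ℝ] C(AddCircle T, ℝ) :=
      deriv ω A₀ • primitiveCLM.comp primitiveCLM
    have hL : ∀ u, L u = deriv ω A₀ • primitiveCLM (primitiveCLM u) := fun u => rfl
    simp only [← hL] at heβ ⊢
    rw [vectorCoeff_congr heβ, vectorCoeff_add ((primitiveCLM.analyticAt _).fun_comp hΦ)
      ((L.analyticAt _).fun_comp hΓ), vectorCoeff_clm primitiveCLM hΦ, vectorCoeff_clm L hΓ]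
  have hcB : ∀ j, vectorCoeff j B = primitiveCLM (vectorCoeff j fun ε => ε • D ε) -
      (meanCLM (vectorCoeff j Φ) / deriv ω A₀) • 1 := by
    intro j
    let L : C(AddCircle T, ℝ) →L[ℝ] C(AddCircle T, ℝ) :=
      -((deriv ω A₀)⁻¹ • meanCLM.smulRight 1)
    have hL : ∀ u, L u = -((meanCLM u / deriv ω A₀) • 1) := fun u => by
      simp [L, div_eq_inv_mul, smul_smul, -meanCLM_apply]
    simp only [sub_eq_add_neg, ← hL] at heB ⊢
    rw [vectorCoeff_congr heB, vectorCoeff_add ((primitiveCLM.analyticAt _).fun_comp hΓ)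
      ((L.analyticAt _).fun_comp hΦ), vectorCoeff_clm primitiveCLM hΓ, vectorCoeff_clm L hΦ]
  induction k with
  | zero =>
    ext ε t <;> simp [approx, truncatedCurve, vectorCoeff_zero, hβ0, hB0]
  | succ k ih =>
    have hΦk := funext (phiCoeff_truncatedCurve hω hF hA₀ hβ hB hΦ hβ0 hB0 hs heΦ k)
    have hΓk := funext (gammaCoeff_truncatedCurve hG hA₀ hβ hB hD hβ0 hB0 hs heD k)
    have hsh : ∀ (u : C(AddCircle T, ℝ)), primitive T (fun t => u (t - s : ℝ)) =
        fun t => primitiveCLM u (t - s : ℝ) := fun u => funext fun t =>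
      primitive_comp_sub hT.out (continuous_circle u) (periodic_circle u) s t
    have hmn : ∀ (u : C(AddCircle T, ℝ)), mean T (fun t => u (t - s : ℝ)) = meanCLM u := fun u =>
      mean_comp_sub (periodic_circle u) s
    funext ε t
    simp only [approx, ih, hΦk, hΓk, hsh, hmn]
    rw [truncatedCurve, truncatedCurve, Finset.sum_range_succ _ (k + 1),
      Finset.sum_range_succ _ (k + 1), hcβ (k + 1), hcB (k + 1)]
    ext
    · simp only [ContinuousMap.add_apply, ContinuousMap.smul_apply, smul_eq_mul]
      ring
    · simp only [ContinuousMap.sub_apply, ContinuousMap.smul_apply, smul_eq_mul,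
        ContinuousMap.one_apply]
      ring

end Recursion

end Subharmonic

end

noncomputable section

namespace Subharmonic

open Filter Topology

/-! ### Melnikov functions as coefficients of the bifurcation equation; return to the differential
equation -/

section Melnikov

theorem taylorCoeff_succ_mul {f : ℝ → ℝ} (hf : AnalyticAt ℝ f 0) (k : ℕ) :
    taylorCoeff (k + 1) (fun x => x * f x) = taylorCoeff k f := by
  obtain ⟨g, hg, hE⟩ := hf.exists_eventuallyEq_sum_add_pow_mul (k + 1)
  have h1 : ∀ᶠ x in 𝓝 0, f x = ∑ j ∈ Finset.range (k + 1), taylorCoeff j f * x ^ j +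
      x ^ (k + 1) * g x := by
    filter_upwards [hE] with x hx
    rw [hx, smul_eq_mul]
    congr 1
    refine Finset.sum_congr rfl fun j _ => ?_
    rw [smul_eq_mul, taylorCoeff]; ring
  have h2 := taylorCoeff_of_eventuallyEq (f := fun x => x * f x) (n := k + 2) (h := g)
    (c := fun j => if j = 0 then 0 else taylorCoeff (j - 1) f) hg ?_ (k := k + 1) (by omega)
  · simpa using h2
  filter_upwards [h1] with x hx
  have h3 : ∑ j ∈ Finset.range (k + 2), (if j = 0 then 0 else taylorCoeff (j - 1) f) * x ^ j =
      x * ∑ j ∈ Finset.range (k + 1), taylorCoeff j f * x ^ j := by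
    rw [Finset.sum_range_succ', Finset.mul_sum]
    simp only [Nat.add_eq_zero_iff, one_ne_zero, and_false, if_false, Nat.add_sub_cancel, if_true,
      zero_mul, add_zero]
    refine Finset.sum_congr rfl fun j _ => ?_
    ring
  rw [h3, hx]
  ring

variable {T : ℝ} [hT : Fact (0 < T)] {W : Set ℝ} {ω : ℝ → ℝ} {F G : ℝ → ℝ → ℝ → ℝ}
  {A₀ t₀ : ℝ}

/-- The mean ignores the time translation by `s` and commutes with taking coefficients in `ε`. The
factor `ε` in `ε • D` lowers the index from `k + 1` to `k`. -/
theorem melnikov_eq_taylorCoeff {β B Φ D : ℝ → C(AddCircle T, ℝ)} {b s : ℝ}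
    (hω : AnalyticAt ℝ ω A₀)
    (hF : AnalyticOnNhd ℝ (fun x : ℝ × ℝ × ℝ => F x.1 x.2.1 x.2.2)
      (Set.univ ×ˢ W ×ˢ Set.univ))
    (hG : AnalyticOnNhd ℝ (fun x : ℝ × ℝ × ℝ => G x.1 x.2.1 x.2.2)
      (Set.univ ×ˢ W ×ˢ Set.univ)) (hA₀ : A₀ ∈ W) {q : ℕ} (hT' : T = 2 * Real.pi * q)
    (hβ : AnalyticAt ℝ β 0) (hB : AnalyticAt ℝ B 0) (hΦ : AnalyticAt ℝ Φ 0) (hD : AnalyticAt ℝ D 0)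
    (hβ0 : β 0 = 0) (hB0 : B 0 = 0) (hs : ω A₀ * s = b)
    (heβ : ∀ᶠ ε in 𝓝 0,
      β ε = primitiveCLM (Φ ε) + deriv ω A₀ • primitiveCLM (primitiveCLM (ε • D ε)))
    (heB : ∀ᶠ ε in 𝓝 0, B ε = primitiveCLM (ε • D ε) - (meanCLM (Φ ε) / deriv ω A₀) • 1)
    (heΦ : ∀ᶠ ε in 𝓝 0, ∀ t : ℝ, Φ ε t = ε * F (ω A₀ * t + (b + β ε t)) (A₀ + B ε t) (t + t₀) +
      (ω (A₀ + B ε t) - ω A₀ - deriv ω A₀ * B ε t))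
    (heD : ∀ᶠ ε in 𝓝 0, ∀ t : ℝ, D ε t = G (ω A₀ * t + (b + β ε t)) (A₀ + B ε t) (t + t₀))
    (k : ℕ) : melnikov ω F G A₀ q k (t₀ - s) = taylorCoeff k fun ε => meanCLM (D ε) := by
  have hΓ : AnalyticAt ℝ (fun ε => ε • D ε) 0 := analyticAt_id.fun_smul hD
  have h1 := approx_eq_truncatedCurve hω hF hG hA₀ hβ hB hΦ hD hβ0 hB0 hs heβ heB heΦ heD k
  have h2 := funext (gammaCoeff_truncatedCurve hG hA₀ hβ hB hD hβ0 hB0 hs heD k)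
  have h3 : mean T (fun t => vectorCoeff (k + 1) (fun ε => ε • D ε) (t - s : ℝ)) =
      meanCLM (vectorCoeff (k + 1) fun ε => ε • D ε) := mean_comp_sub (periodic_circle _) s
  have h4 : taylorCoeff (k + 1) (fun ε => ε * meanCLM (D ε)) =
      meanCLM (vectorCoeff (k + 1) fun ε => ε • D ε) := by
    rw [← vectorCoeff_clm meanCLM hΓ, vectorCoeff_eq_taylorCoeff]
    simp only [map_smul, smul_eq_mul]
  rw [← taylorCoeff_succ_mul ((meanCLM.analyticAt _).fun_comp hD) k, h4, ← h3, ← h2, ← h1]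
  simp only [melnikov, hT']

/-- A solution of the range equations for which `G` has zero average gives a subharmonic
solution. -/
theorem isPeriodicSolution_of_range_equations {β B Φ D : C(AddCircle T, ℝ)} {b ε : ℝ} {p : ℤ}
    {q : ℕ} (hT' : T = 2 * Real.pi * q) (hν : ω A₀ * T = 2 * Real.pi * p)
    (htwist : deriv ω A₀ ≠ 0) (hW : ∀ t : ℝ, A₀ + B t ∈ W)
    (hβ : β = primitiveCLM Φ + deriv ω A₀ • primitiveCLM (primitiveCLM (ε • D)))
    (hB : B = primitiveCLM (ε • D) - (meanCLM Φ / deriv ω A₀) • 1)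
    (hΦ : ∀ t : ℝ, Φ t = ε * F (ω A₀ * t + (b + β t)) (A₀ + B t) (t + t₀) +
      (ω (A₀ + B t) - ω A₀ - deriv ω A₀ * B t))
    (hD : ∀ t : ℝ, D t = G (ω A₀ * t + (b + β t)) (A₀ + B t) (t + t₀)) (hmean : meanCLM D = 0) :
    IsPeriodicSolution W ω F G p q t₀ ε (fun t => ω A₀ * t + (b • (1 : C(AddCircle T, ℝ)) + β) t)
      (fun t => A₀ + B t) := by
  have hP : ∀ (u : C(AddCircle T, ℝ)) (t : ℝ), HasDerivAt (fun t : ℝ => primitiveCLM u t)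
      (u t - meanCLM u) t := fun u t => hasDerivAt_primitive (continuous_circle u) t
  have hb : ∀ t : ℝ, (b • (1 : C(AddCircle T, ℝ)) + β) t = b + β t := fun t => by simp
  have hβt : ∀ t : ℝ, β t = primitiveCLM Φ t +
      deriv ω A₀ * primitiveCLM (primitiveCLM (ε • D)) t := fun t => by
    conv_lhs => rw [hβ]
    rfl
  have hBt : ∀ t : ℝ, B t = primitiveCLM (ε • D) t - meanCLM Φ / deriv ω A₀ := fun t => by
    conv_lhs => rw [hB]
    simp [-meanCLM_apply]
  -- Differentiating the double primitive would leave the mean of the inner one, which is zero.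
  have hPmean : meanCLM (primitiveCLM (ε • D)) = 0 := by
    have hc := continuous_integral_sub_mean (T := T) (continuous_circle (ε • D))
    have h1 : ∀ t : ℝ, primitiveCLM (ε • D) t =
      (∫ s in (0 : ℝ)..t, ((ε • D) s - mean T fun t => (ε • D) t)) +
        -mean T (fun u => ∫ s in (0 : ℝ)..u, ((ε • D) s - mean T fun t => (ε • D) t)) :=
      fun t => rfl
    rw [meanCLM_apply]
    simp only [h1]
    rw [mean_add hc continuous_const, mean_const hT.out, add_neg_cancel]
  refine ⟨hW, fun t => ?_, fun t => ?_, fun t => ?_, fun t => ?_⟩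
  · simp only [hb]
    simp only [hβt]
    have h1 := ((hasDerivAt_id t).const_mul (ω A₀)).fun_add
      (((hP Φ t).fun_add ((hP (primitiveCLM (ε • D)) t).const_mul (deriv ω A₀))).const_add b)
    refine h1.congr_deriv ?_
    simp only [← hβt]
    rw [hPmean, hΦ t]
    have h2 := hBt t
    -- The constant in `B` is chosen so that `ω'(A₀)𝓘Γ = ω'(A₀)B + ⟨Φ⟩`, which cancels the `-⟨Φ⟩`
    -- from differentiating `𝓘Φ`.
    have h3 : primitiveCLM (ε • D) t = B t + meanCLM Φ / deriv ω A₀ := by linarith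
    rw [h3, sub_zero, mul_add, mul_div_cancel₀ _ htwist]
    ring
  · have h1 : HasDerivAt (fun t : ℝ => B t) ((ε • D) t - meanCLM (ε • D)) t := by
      simp only [hBt]
      exact (hP (ε • D) t).sub_const _
    refine (h1.const_add A₀).congr_deriv ?_
    -- Only here does the bifurcation equation enter: `𝓘Γ` has derivative `Γ - ⟨Γ⟩`.
    rw [map_smul, hmean, smul_zero, sub_zero, ContinuousMap.smul_apply, hD t, hb, smul_eq_mul]
  · rw [← hT', AddCircle.coe_add_period, mul_add, hν]
    ring
  · rw [← hT', AddCircle.coe_add_period]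

end Melnikov

/-! ### From analytic functions of `|ε|^{1/N}` to Puiseux series -/

section PuiseuxSeries

variable {T : ℝ} [hT : Fact (0 < T)]

theorem exists_series {f : ℝ → C(AddCircle T, ℝ)} (hf : AnalyticAt ℝ f 0) :
    ∃ (c : ℕ → C(AddCircle T, ℝ)) (ρ : ℝ), 0 < ρ ∧ c 0 = f 0 ∧
      (Summable fun h => ‖c h‖ * ρ ^ h) ∧ ∀ w, |w| < ρ → HasSum (fun h => w ^ h • c h) (f w) := by
  obtain ⟨p, r, hp⟩ := hf
  obtain ⟨ρ, hρ0, hρ⟩ := ENNReal.lt_iff_exists_nnreal_btwn.1 hp.r_pos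
  refine ⟨p.coeff, ρ, by exact_mod_cast hρ0, hp.coeff_zero _, ?_, fun w hw => ?_⟩
  · simpa only [FormalMultilinearSeries.norm_apply_eq_norm_coef] using
      p.summable_norm_mul_pow (hρ.trans_le hp.r_le)
  · have hw' : w ∈ Metric.eball (0 : ℝ) r := by
      rw [Metric.mem_eball, edist_zero_right]
      refine lt_trans ?_ hρ
      rw [enorm_eq_nnnorm, ENNReal.coe_lt_coe, ← NNReal.coe_lt_coe]
      simpa using hw
    have := hp.hasSum hw'
    rw [zero_add] at this
    simpa using this

/-- Substituting `w = |ε|^{1/N}` in the power series of `f₁` and `f₂` serves the two half-lines. All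
radii `r ≤ ρ` are allowed, so that several series can later share one `ε₀`. -/
theorem hasPuiseuxSeries_of_analyticAt {f₁ f₂ : ℝ → C(AddCircle T, ℝ)} (hf₁ : AnalyticAt ℝ f₁ 0)
    (hf₂ : AnalyticAt ℝ f₂ 0) (h₁ : f₁ 0 = 0) (h₂ : f₂ 0 = 0) {N : ℕ} (hN : N ≠ 0) :
    ∃ ρ > 0, ∀ r > 0, r ≤ ρ → HasPuiseuxSeries N T (r ^ N) fun ε t =>
      (if 0 ≤ ε then f₁ (|ε| ^ (N : ℝ)⁻¹) else f₂ (|ε| ^ (N : ℝ)⁻¹)) (t : AddCircle T) := by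
  have key : ∀ f : ℝ → C(AddCircle T, ℝ), AnalyticAt ℝ f 0 → f 0 = 0 →
      ∃ ρ > 0, ∀ r > 0, r ≤ ρ → ∃ (c : ℕ → ℝ → ℝ) (b : ℕ → ℝ), (∀ t, c 0 t = 0) ∧
        (∀ h, Continuous (c h)) ∧ (∀ h, Function.Periodic (c h) T) ∧ (∀ h t, |c h t| ≤ b h) ∧
        Summable (fun h => b h * (r ^ N) ^ ((h : ℝ) / (N : ℝ))) ∧ ∀ ε : ℝ, |ε| < r ^ N → ∀ t : ℝ,
          HasSum (fun h => c h t * |ε| ^ ((h : ℝ) / (N : ℝ))) (f (|ε| ^ (N : ℝ)⁻¹) t) := by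
    intro f hf hf0
    obtain ⟨c, ρ, hρ, hc0, hsum, hser⟩ := exists_series hf
    have hN' : (N : ℝ) ≠ 0 := by exact_mod_cast hN
    refine ⟨ρ, hρ, fun r hr hrρ => ⟨fun h t => c h t, fun h => ‖c h‖, fun t => by simp [hc0, hf0],
      fun h => continuous_circle _, fun h => periodic_circle _, fun h t => abs_circle_le _ _,
      ?_, fun ε hε t => ?_⟩⟩
    · refine Summable.of_nonneg_of_le (fun h => by positivity) (fun h => ?_) hsum
      rw [← Real.rpow_natCast r N, ← Real.rpow_mul hr.le, mul_div_cancel₀ _ hN', Real.rpow_natCast]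
      gcongr
    · set w := |ε| ^ (N : ℝ)⁻¹ with hw
      have hw0 : 0 ≤ w := Real.rpow_nonneg (abs_nonneg _) _
      have hwr : |w| < ρ := by
        rw [abs_of_nonneg hw0]
        refine lt_of_lt_of_le ?_ hrρ
        rw [← Real.pow_rpow_inv_natCast hr.le hN]
        exact Real.rpow_lt_rpow (abs_nonneg _) hε (by positivity)
      have h1 := (ContinuousMap.evalCLM ℝ (t : AddCircle T)).hasSum (hser w hwr)
      have h2 : ∀ h : ℕ, w ^ h = |ε| ^ ((h : ℝ) / (N : ℝ)) := fun h => by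
        rw [hw, ← Real.rpow_natCast, ← Real.rpow_mul (abs_nonneg _), inv_mul_eq_div]
      have h3 : (fun h => c h t * |ε| ^ ((h : ℝ) / (N : ℝ))) =
          ContinuousMap.evalCLM ℝ (t : AddCircle T) ∘ fun h => w ^ h • c h := by
        funext h
        rw [Function.comp_apply, map_smul, smul_eq_mul, mul_comm, h2]
        rfl
      rw [h3]
      exact h1
  obtain ⟨ρ₁, hρ₁, H₁⟩ := key f₁ hf₁ h₁
  obtain ⟨ρ₂, hρ₂, H₂⟩ := key f₂ hf₂ h₂
  refine ⟨min ρ₁ ρ₂, lt_min hρ₁ hρ₂, fun r hr hrρ σ hσ => ?_⟩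
  rcases hσ with rfl | rfl
  · obtain ⟨c, b, h0, hc, hp, hb, hs, hsum⟩ := H₁ r hr (hrρ.trans (min_le_left _ _))
    refine ⟨c, b, h0, hc, hp, hb, hs, fun ε hε hσ t => ?_⟩
    rw [one_mul] at hσ
    simp only [hσ, if_true]
    exact hsum ε hε t
  · obtain ⟨c, b, h0, hc, hp, hb, hs, hsum⟩ := H₂ r hr (hrρ.trans (min_le_right _ _))
    refine ⟨c, b, h0, hc, hp, hb, hs, fun ε hε hσ t => ?_⟩
    have h3 := hsum ε hε t
    by_cases hε0 : 0 ≤ ε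
    -- The half-lines meet only at `ε = 0`, where the definition picks `f₁`; both functions vanish
    -- there.
    · obtain rfl : ε = 0 := by linarith
      have hN' : (N : ℝ)⁻¹ ≠ 0 := by positivity
      simp only [abs_zero, Real.zero_rpow hN', h₂] at h3
      simpa only [le_refl, if_true, abs_zero, Real.zero_rpow hN', h₁] using h3
    · simp only [hε0, if_false]
      exact h3

end PuiseuxSeries

end Subharmonic

end

noncomputable section

namespace Subharmonic

open Filter Topology

/-! ### Division of the bifurcation equation by `ε ^ κ` -/

section BifurcationFunction

/-- If the coefficients of `H (b, ·)` of order less than `κ` vanish and the one of order `κ` has a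
zero of order `n` as a function of `b`, then `H` is `ε ^ κ` times a function regular of order `n`
in `b`. -/
theorem exists_bifurcation_function {H : ℝ × ℝ → ℝ} (hH : AnalyticAt ℝ H 0) {M : ℕ → ℝ → ℝ}
    {ν t₀ : ℝ} (hν : ν ≠ 0)
    (hM : ∀ᶠ b in 𝓝 (0 : ℝ), ∀ k, M k (t₀ - b / ν) = taylorCoeff k fun ε => H (b, ε)) {κ n : ℕ}
    (hvanish : ∀ k < κ, ∀ s, M k s = 0) (hzero : ∀ j < n, iteratedDeriv j (M κ) t₀ = 0)
    (hne : iteratedDeriv n (M κ) t₀ ≠ 0) :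
    ∃ g : ℝ × ℝ → ℝ, AnalyticAt ℝ g 0 ∧ analyticOrderAt (fun b => g (0, b)) 0 = n ∧
      ∀ᶠ e in 𝓝 (0 : ℝ × ℝ), H e = e.2 ^ κ * g (e.2, e.1) := by
  obtain ⟨a, h, ha, hh, hE⟩ := exists_fiber_taylor (e := (0 : ℝ)) (f := H) hH (κ + 1)
  have hline : Tendsto (fun b : ℝ => (b, (0 : ℝ))) (𝓝 0) (𝓝 (0, 0)) :=
    (continuous_id.prodMk continuous_const).tendsto' _ _ rfl
  have hcoeff : ∀ᶠ b in 𝓝 (0 : ℝ), ∀ j < κ + 1, a j b = M j (t₀ - b / ν) := by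
    filter_upwards [hE.curry_nhds, hM, hline.eventually hh.eventually_analyticAt] with b h1 h2 h3
    intro j hj
    rw [h2 j]
    refine (taylorCoeff_of_eventuallyEq (h := fun ε => h (b, ε)) ?_ h1 hj).symm
    exact h3.comp_of_eq (f := fun ε : ℝ => (b, ε)) (by fun_prop) rfl
  have hvan : ∀ᶠ e in 𝓝 (0 : ℝ × ℝ), ∀ j < κ, a j e.1 = 0 := by
    have h1 : Tendsto (fun e : ℝ × ℝ => e.1) (𝓝 0) (𝓝 0) := continuous_fst.tendsto' _ _ rfl
    filter_upwards [h1.eventually hcoeff] with e he j hj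
    rw [he j (by omega), hvanish j hj]
  have hswap : AnalyticAt ℝ (fun v : ℝ × ℝ => (v.2, v.1)) 0 := by fun_prop
  refine ⟨fun v => a κ v.2 + v.1 * h (v.2, v.1), ?_, ?_, ?_⟩
  · refine AnalyticAt.fun_add ((ha κ).comp_of_eq (f := fun v : ℝ × ℝ => v.2) (by fun_prop) rfl)
      (AnalyticAt.fun_mul (by fun_prop) (hh.comp_of_eq hswap rfl))
  · have h1 : (fun b => a κ b + 0 * h (b, 0)) =ᶠ[𝓝 0] M κ ∘ fun b => t₀ - b / ν := by
      filter_upwards [hcoeff] with b hb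
      simp [hb κ (by omega)]
    -- Analyticity of `M κ` near `t₀` is inherited from `a κ` through the inverse substitution `b =
    -- ν (t₀ - τ)`.
    have h2 : AnalyticAt ℝ (M κ) t₀ := by
      have h3 : Tendsto (fun τ : ℝ => ν * (t₀ - τ)) (𝓝 t₀) (𝓝 0) :=
        Continuous.tendsto' (by fun_prop) _ _ (by simp)
      refine AnalyticAt.congr (f := fun τ => a κ (ν * (t₀ - τ))) ?_ ?_
      · exact (ha κ).comp_of_eq (f := fun τ : ℝ => ν * (t₀ - τ)) (by fun_prop) (by simp)
      · filter_upwards [h3.eventually hcoeff] with τ hτ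
        rw [hτ κ (by omega), mul_div_cancel_left₀ _ hν, sub_sub_cancel]
    have h4 : AnalyticAt ℝ (fun b : ℝ => t₀ - b / ν) 0 := by
      simp only [div_eq_mul_inv]; fun_prop
    have h5 : deriv (fun b : ℝ => t₀ - b / ν) 0 ≠ 0 := by
      have : HasDerivAt (fun b : ℝ => t₀ - b / ν) (-(1 / ν)) 0 :=
        ((hasDerivAt_id 0).div_const ν).const_sub t₀
      rw [this.deriv]
      simpa using hν
    have h6 : t₀ - 0 / ν = t₀ := by simp
    -- The affine substitution `b ↦ t₀ - b / ν` has nonzero slope, so it preserves the order of the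
    -- zero.
    rw [analyticOrderAt_congr h1, analyticOrderAt_comp_of_deriv_ne_zero h4 h5, h6,
      analyticOrderAt_eq_nat_iff_iteratedDeriv_eq_zero h2]
    exact ⟨hzero, hne⟩
  · filter_upwards [hE, hvan] with e h1 h2
    rw [h1, Finset.sum_range_succ,
      Finset.sum_eq_zero fun j hj => by rw [h2 j (Finset.mem_range.1 hj), zero_mul]]
    ring

end BifurcationFunction

/-! ### Real branches over a half-line -/

section Branch

/-- A zero set germ `g (ε, b) = 0` of odd order in `b` contains a branch over either half-line
`σ ε ≥ 0`, parametrized by the `n!`-th root of `|ε|`. -/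
theorem exists_branch {g : ℝ × ℝ → ℝ} (hg : AnalyticAt ℝ g 0) {n : ℕ} (hn : Odd n)
    (hord : analyticOrderAt (fun b => g (0, b)) 0 = n) (σ : ℝ) :
    ∃ φ : ℝ → ℝ, AnalyticAt ℝ φ 0 ∧ φ 0 = 0 ∧
      ∀ᶠ w in 𝓝 (0 : ℝ), g (σ * w ^ n.factorial, φ w) = 0 := by
  have hg' : AnalyticAt ℝ (fun v : ℝ × ℝ => g (σ * v.1, v.2)) 0 :=
    hg.comp_of_eq (f := fun v : ℝ × ℝ => (σ * v.1, v.2)) (by fun_prop) (by simp)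
  obtain ⟨N, φ, hN, ⟨d, hd⟩, hφ, hφ0, hE⟩ := exists_puiseux_root n hn _ hg' (by simpa using hord)
  have hd0 : 0 < d := Nat.pos_of_mul_pos_left (hd ▸ n.factorial_pos)
  -- Since `N * d = n!`, setting `v = w ^ d` replaces the denominator `N` by the uniform `n!`.
  refine ⟨fun w => φ (w ^ d), analyticAt_comp_pow hφ hd0, by simp [hd0.ne', hφ0], ?_⟩
  filter_upwards [(tendsto_pow_nhds_zero hd0).eventually hE] with w hw
  rwa [← pow_mul, mul_comm d, ← hd] at hw

end Branch

end Subharmonic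

end

noncomputable section

namespace Subharmonic

open Filter Topology

/-! ### Assembly of the periodic solutions -/

variable {T : ℝ} [hT : Fact (0 < T)] {W : Set ℝ} {ω : ℝ → ℝ} {F G : ℝ → ℝ → ℝ → ℝ}

/-- The periodic solutions over either half-line `σ ε ≥ 0`, as analytic functions of the `n!`-th
root of `|ε|`. -/
theorem exists_periodicSolution_branch (hW : IsOpen W)
    (hω : AnalyticOnNhd ℝ ω W)
    (hF : AnalyticOnNhd ℝ (fun x : ℝ × ℝ × ℝ => F x.1 x.2.1 x.2.2)
      (Set.univ ×ˢ W ×ˢ Set.univ))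
    (hG : AnalyticOnNhd ℝ (fun x : ℝ × ℝ × ℝ => G x.1 x.2.1 x.2.2)
      (Set.univ ×ˢ W ×ˢ Set.univ))
    (hFα : ∀ α t, ∀ A ∈ W, F (α + 2 * Real.pi) A t = F α A t)
    (hFt : ∀ α t, ∀ A ∈ W, F α A (t + 2 * Real.pi) = F α A t)
    (hGα : ∀ α t, ∀ A ∈ W, G (α + 2 * Real.pi) A t = G α A t)
    (hGt : ∀ α t, ∀ A ∈ W, G α A (t + 2 * Real.pi) = G α A t)
    {p : ℤ} {q : ℕ} (hT' : T = 2 * Real.pi * q) {A₀ : ℝ} (hA₀ : A₀ ∈ W)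
    (hν : ω A₀ * T = 2 * Real.pi * p) (hν0 : ω A₀ ≠ 0) (htwist : deriv ω A₀ ≠ 0)
    {κ n : ℕ} (hn : Odd n) (hvanish : ∀ k < κ, ∀ s : ℝ, melnikov ω F G A₀ q k s = 0) {t₀ : ℝ}
    (hzero : ∀ j < n, iteratedDeriv j (melnikov ω F G A₀ q κ) t₀ = 0)
    (hne : iteratedDeriv n (melnikov ω F G A₀ q κ) t₀ ≠ 0) (σ : ℝ) :
    ∃ U V : ℝ → C(AddCircle T, ℝ), AnalyticAt ℝ U 0 ∧ AnalyticAt ℝ V 0 ∧ U 0 = 0 ∧ V 0 = 0 ∧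
      ∀ᶠ w in 𝓝 (0 : ℝ), IsPeriodicSolution W ω F G p q t₀ (σ * w ^ n.factorial)
        (fun t => ω A₀ * t + U w t) (fun t => A₀ + V w t) := by
  obtain ⟨β, B, Φ, D, hβ, hB, hΦ, hD, h0, hE⟩ :=
    exists_reduction hW hω hF hG hFα hFt hGα hGt hT' hν hA₀ t₀
  have hline : Tendsto (fun b : ℝ => (b, (0 : ℝ))) (𝓝 0) (𝓝 0) :=
    (continuous_id.prodMk continuous_const).tendsto' _ _ rfl
  have hfib : ∀ {f : ℝ × ℝ → C(AddCircle T, ℝ)} {b : ℝ}, AnalyticAt ℝ f (b, 0) →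
      AnalyticAt ℝ (fun ε => f (b, ε)) 0 := fun {f b} hf =>
    hf.comp_of_eq (f := fun ε : ℝ => (b, ε)) (by fun_prop) rfl
  have hM : ∀ᶠ b in 𝓝 (0 : ℝ), ∀ k, melnikov ω F G A₀ q k (t₀ - b / ω A₀) =
      taylorCoeff k fun ε => meanCLM (D (b, ε)) := by
    have hE' : ∀ᶠ e in 𝓝 ((0 : ℝ), (0 : ℝ)), _ := hE
    -- For each fixed small `b` the range equations hold for all `ε` near `0`, which is all that
    -- Taylor coefficients at `ε = 0` need.
    filter_upwards [hE'.curry_nhds, h0, hline.eventually hβ.eventually_analyticAt,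
      hline.eventually hB.eventually_analyticAt, hline.eventually hΦ.eventually_analyticAt,
      hline.eventually hD.eventually_analyticAt] with b hb hb0 hbβ hbB hbΦ hbD k
    exact melnikov_eq_taylorCoeff (hω A₀ hA₀) hF hG hA₀ hT' (hfib hbβ) (hfib hbB) (hfib hbΦ)
      (hfib hbD) hb0.1 hb0.2 (mul_div_cancel₀ b hν0) (hb.mono fun _ h => h.1)
      (hb.mono fun _ h => h.2.1) (hb.mono fun _ h => h.2.2.2.1) (hb.mono fun _ h => h.2.2.2.2) k
  obtain ⟨g, hg, hord, hHg⟩ := exists_bifurcation_function (H := fun e => meanCLM (D e))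
    ((meanCLM.analyticAt _).fun_comp hD) hν0 hM hvanish hzero hne
  obtain ⟨φ, hφ, hφ0, hroot⟩ := exists_branch hg hn hord σ
  have he : AnalyticAt ℝ (fun w : ℝ => (φ w, σ * w ^ n.factorial)) 0 :=
    hφ.prod (by fun_prop)
  have he0 : (φ 0, σ * 0 ^ n.factorial) = (0 : ℝ × ℝ) := by
    rw [hφ0, zero_pow n.factorial_ne_zero, mul_zero]; rfl
  have hlim : Tendsto (fun w : ℝ => (φ w, σ * w ^ n.factorial)) (𝓝 0) (𝓝 0) := by
    simpa only [he0] using he.continuousAt.tendsto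
  have h00 := h0.self_of_nhds
  refine ⟨fun w => φ w • 1 + β (φ w, σ * w ^ n.factorial), fun w => B (φ w, σ * w ^ n.factorial),
    (hφ.fun_smul analyticAt_const).fun_add (hβ.comp_of_eq he he0), hB.comp_of_eq he he0, ?_, ?_, ?_⟩
  · simp only [he0]
    rw [hφ0, zero_smul, zero_add]
    exact h00.1
  · simp only [he0]
    exact h00.2
  · filter_upwards [hroot, hlim.eventually hHg, hlim.eventually hE] with w h1 h2 h3
    exact isPeriodicSolution_of_range_equations hT' hν htwist h3.2.2.1 h3.1 h3.2.1 h3.2.2.2.1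
      h3.2.2.2.2 (by rw [h2]; simp only [h1, mul_zero])

end Subharmonic

end

theorem theorem4 (W : Set ℝ) (hW : IsOpen W)
    (ω : ℝ → ℝ) (F G : ℝ → ℝ → ℝ → ℝ)
    (hω : AnalyticOnNhd ℝ ω W)
    (hF : AnalyticOnNhd ℝ (fun x : ℝ × ℝ × ℝ => F x.1 x.2.1 x.2.2)
      (Set.univ ×ˢ W ×ˢ Set.univ))
    (hG : AnalyticOnNhd ℝ (fun x : ℝ × ℝ × ℝ => G x.1 x.2.1 x.2.2)
      (Set.univ ×ˢ W ×ˢ Set.univ))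
    (hFα : ∀ α t, ∀ A ∈ W, F (α + 2 * Real.pi) A t = F α A t)
    (hFt : ∀ α t, ∀ A ∈ W, F α A (t + 2 * Real.pi) = F α A t)
    (hGα : ∀ α t, ∀ A ∈ W, G (α + 2 * Real.pi) A t = G α A t)
    (hGt : ∀ α t, ∀ A ∈ W, G α A (t + 2 * Real.pi) = G α A t)
    (p : ℤ) (q : ℕ) (hp : p ≠ 0) (hq : 0 < q) (hpq : IsCoprime p (q : ℤ))
    (A₀ : ℝ) (hA₀ : A₀ ∈ W) (hres : ω A₀ = (p : ℝ) / (q : ℝ)) (htwist : deriv ω A₀ ≠ 0)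
    (κ n : ℕ) (hn : Odd n)
    (hvanish : ∀ k < κ, ∀ s : ℝ, Subharmonic.melnikov ω F G A₀ q k s = 0)
    (t₀ : ℝ) (ht₀ : t₀ ∈ Set.Ico 0 (2 * Real.pi))
    (hzero : ∀ j < n, iteratedDeriv j (Subharmonic.melnikov ω F G A₀ q κ) t₀ = 0)
    (hne : iteratedDeriv n (Subharmonic.melnikov ω F G A₀ q κ) t₀ ≠ 0) :
    ∃ ε₀ : ℝ, 0 < ε₀ ∧ ∃ α A : ℝ → ℝ → ℝ,
      (∀ ε : ℝ, |ε| < ε₀ →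
        Subharmonic.IsPeriodicSolution W ω F G p q t₀ ε (α ε) (A ε)) ∧
      Subharmonic.HasPuiseuxSeries n.factorial (2 * Real.pi * q) ε₀
        (fun ε t => α ε t - ω A₀ * t) ∧
      Subharmonic.HasPuiseuxSeries n.factorial (2 * Real.pi * q) ε₀
        (fun ε t => A ε t - A₀) := by
  have hq' : (0 : ℝ) < q := by exact_mod_cast hq
  have hT : Fact ((0 : ℝ) < 2 * Real.pi * q) := ⟨by positivity⟩
  have hν : ω A₀ * (2 * Real.pi * q) = 2 * Real.pi * p := by
    rw [hres]; field_simp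
  have hν0 : ω A₀ ≠ 0 := by
    rw [hres]
    exact div_ne_zero (by exact_mod_cast hp) hq'.ne'
  have branch := Subharmonic.exists_periodicSolution_branch hW hω hF hG hFα hFt hGα hGt rfl hA₀ hν
    hν0 htwist hn hvanish hzero hne
  -- The branches over `ε ≥ 0` and `ε ≤ 0` are chosen independently; they agree at `ε = 0` since
  -- both vanish there.
  obtain ⟨U₁, V₁, hU₁, hV₁, hU₁0, hV₁0, H₁⟩ := branch 1
  obtain ⟨U₂, V₂, hU₂, hV₂, hU₂0, hV₂0, H₂⟩ := branch (-1)
  have hN := n.factorial_ne_zero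
  obtain ⟨ρ₁, hρ₁, hU⟩ := Subharmonic.hasPuiseuxSeries_of_analyticAt hU₁ hU₂ hU₁0 hU₂0 hN
  obtain ⟨ρ₂, hρ₂, hV⟩ := Subharmonic.hasPuiseuxSeries_of_analyticAt hV₁ hV₂ hV₁0 hV₂0 hN
  obtain ⟨δ, hδ, H⟩ := Metric.eventually_nhds_iff.1 (H₁.and H₂)
  -- One radius in `w = |ε|^{1/n!}` for both series and for the validity of the solutions; then `ε₀
  -- = r ^ n!`.
  obtain ⟨r, hr, hrρ₁, hrρ₂, hrδ⟩ : ∃ r : ℝ, 0 < r ∧ r ≤ ρ₁ ∧ r ≤ ρ₂ ∧ r ≤ δ :=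
    ⟨min ρ₁ (min ρ₂ δ), lt_min hρ₁ (lt_min hρ₂ hδ), min_le_left _ _,
      (min_le_right _ _).trans (min_le_left _ _), (min_le_right _ _).trans (min_le_right _ _)⟩
  refine ⟨r ^ n.factorial, pow_pos hr _,
    fun ε t => ω A₀ * t + (if 0 ≤ ε then U₁ (|ε| ^ (n.factorial : ℝ)⁻¹)
      else U₂ (|ε| ^ (n.factorial : ℝ)⁻¹)) (t : AddCircle (2 * Real.pi * q)),
    fun ε t => A₀ + (if 0 ≤ ε then V₁ (|ε| ^ (n.factorial : ℝ)⁻¹)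
      else V₂ (|ε| ^ (n.factorial : ℝ)⁻¹)) (t : AddCircle (2 * Real.pi * q)), fun ε hε => ?_, ?_, ?_⟩
  · set w := |ε| ^ (n.factorial : ℝ)⁻¹ with hw
    have hw0 : 0 ≤ w := Real.rpow_nonneg (abs_nonneg _) _
    have hwr : w < r := by
      rw [← Real.pow_rpow_inv_natCast hr.le hN]
      exact Real.rpow_lt_rpow (abs_nonneg _) hε (by positivity)
    have hwN : w ^ n.factorial = |ε| := Real.rpow_inv_natCast_pow (abs_nonneg _) hN
    have h1 := H (y := w) (by rw [Real.dist_0_eq_abs, abs_of_nonneg hw0]; exact hwr.trans_le hrδ)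
    rw [hwN] at h1
    by_cases h2 : 0 ≤ ε
    · simp only [h2, if_true, ← hw]
      rw [abs_of_nonneg h2, one_mul] at h1
      exact h1.1
    · simp only [h2, if_false, ← hw]
      rw [abs_of_neg (not_le.1 h2), neg_one_mul, neg_neg] at h1
      exact h1.2
  · simpa only [add_sub_cancel_left] using hU r hr hrρ₁
  · simpa only [add_sub_cancel_left] using hV r hr hrρ₂
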